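/- Let $k$ be a field, $n\ge 1$ an integer, and $\mathcal C$ a $k$-linear additive category whose Hom-spaces are finite-dimensional over $k$ and which is Krull–Schmidt (every object is a finite direct sum of objects with local endomorphism rings). Let $\mathcal X$ be an $n$-exact structure on $\mathcal C$ in the sense of Jasso, that is, a class of $n$-exact sequences $$X^0\xrightarrow{d^0}X^1\xrightarrow{d^1}\cdots\xrightarrow{d^{n-1}}X^n\xrightarrow{d^n}X^{n+1}$$ (complexes such that $(d^0,\dots,d^{n-1})$ is an $n$-kernel of $d^n$ and $(d^1,\dots,d^n)$ is an $n$-cokernel of $d^0$), called admissible, which is closed under weak isomorphisms, contains the zero sequence, whose first morphisms $d^0$ (admissible monomorphisms) and whose last morphisms $d^n$ (admissible epimorphisms) are each closed under composition, and such that for every admissible sequence $X$ * every morphism $X^0\to Y^0$ admits an $n$-pushout diagram of $X^0\to\cdots\to X^n$ along it whose first morphism $Y^0\to Y^1$ is an admissible monomorphism, and * every morphism $Y^{n+1}\to X^{n+1}$ admits an $n$-pullback diagram of $X^1\to\cdots\to X^{n+1}$ along it whose last morphism $Y^n\to Y^{n+1}$ is an admissible epimorphism. Here a weak isomorphism is a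 morphism $f$ of $n$-exact sequences such that $f^i$ and $f^{i+1}$ are isomorphisms for some $i\in\{0,\dots,n+1\}$, where $n+2:=0$. That $(d^0,\dots,d^{n-1})$ is an $n$-kernel of $d^n$ means that $0\to\mathcal C(W,X^0)\to\cdots\to\mathcal C(W,X^{n})\to\mathcal C(W,X^{n+1})$ is exact for all $W\in\mathcal C$, and $n$-cokernels are defined dually. A morphism $f$ of complexes from $X^0\to\cdots\to X^n$ to $Y^0\to\cdots\to Y^n$ is an $n$-pushout diagram along $f^0$ if in its mapping cone $X^0\to X^1\oplus Y^0\to\cdots\to X^n\oplus Y^{n-1}\to Y^n$, with differentials $\begin{pmatrix}-d_X&0\\ f&d_Y\end{pmatrix}$, the morphisms after the first one form an $n$-cokernel of the first one; $n$-pullback diagrams are defined dually. Suppose that $\mathcal C$ is locally finite: for every indecomposable object $X$ there are, up to isomorphism, only finitely many indecomposable objects $Y$ with $\operatorname{Hom}_{\mathcal C}(X,Y)\ne 0$ and only finitely many with $\operatorname{Hom}_{\mathcal C}(Y,X)\neq 0$. Then $(\mathcal C,\mathcal X)$ has $n$-Auslander–Reiten sequences: for every indecomposable non-projective object $A$ there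 is an $n$-Auslander–Reiten sequence with $X^{n+1}\cong A$, and for every indecomposable non-injective object $B$ there is an $n$-Auslander–Reiten sequence with $X^0\cong B$. Here an $n$-Auslander–Reiten sequence is an admissible $n$-exact sequence such that $d^0$ is left almost split, $d^n$ is right almost split and, if $n\ge2$, $d^1,\dots,d^{n-1}$ lie in the Jacobson radical $\operatorname{rad}_{\mathcal C}$ of the category. A morphism $f\colon A\to B$ is left almost split if it is not a split monomorphism and every morphism $A\to Z$ that is not a split monomorphism factors through $f$; right almost split morphisms are defined dually. An object $P$ is projective if every morphism $P\to X^{n+1}$ lifts along $d^n$ for every admissible sequence $X$, and an object $I$ is injective if every morphism $X^0\to I$ extends along $d^0$ for every admissible sequence $X$. -/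

import Mathlib

open CategoryTheory CategoryTheory.Limits

universe w v u

namespace HigherExact

section Basic

variable {C : Type u} [Category.{v} C] [Preadditive C]

/-- A complex `X⁰ ⟶ X¹ ⟶ ⋯` has all its nonzero terms in degrees `0, …, m`, so that it is a
complex `X⁰ ⟶ ⋯ ⟶ Xᵐ`. -/
def SupportedUpTo (m : ℕ) (X : CochainComplex C ℕ) : Prop :=
  ∀ i, m < i → IsZero (X.X i)

/-- For a complex `X⁰ ⟶ ⋯ ⟶ Xⁿ⁺¹`: the sequence `(d⁰, …, dⁿ⁻¹)` is an `n`-kernel of `dⁿ`, that is,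
`0 ⟶ Hom(W, X⁰) ⟶ Hom(W, X¹) ⟶ ⋯ ⟶ Hom(W, Xⁿ) ⟶ Hom(W, Xⁿ⁺¹)` is exact for all `W`. -/
structure IsNKernel (n : ℕ) (X : CochainComplex C ℕ) : Prop where
  eq_zero : ∀ (W : C) (a : W ⟶ X.X 0), a ≫ X.d 0 1 = 0 → a = 0
  exact : ∀ i, i < n → ∀ (W : C) (a : W ⟶ X.X (i + 1)), a ≫ X.d (i + 1) (i + 2) = 0 →
    ∃ b : W ⟶ X.X i, b ≫ X.d i (i + 1) = a

/-- For a complex `X⁰ ⟶ ⋯ ⟶ Xⁿ⁺¹`: the sequence `(d¹, …, dⁿ)` is an `n`-cokernel of `d⁰`, that is,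
`0 ⟶ Hom(Xⁿ⁺¹, W) ⟶ Hom(Xⁿ, W) ⟶ ⋯ ⟶ Hom(X¹, W) ⟶ Hom(X⁰, W)` is exact for all `W`. -/
structure IsNCokernel (n : ℕ) (X : CochainComplex C ℕ) : Prop where
  eq_zero : ∀ (W : C) (a : X.X (n + 1) ⟶ W), X.d n (n + 1) ≫ a = 0 → a = 0
  exact : ∀ i, i < n → ∀ (W : C) (a : X.X (i + 1) ⟶ W), X.d i (i + 1) ≫ a = 0 →
    ∃ b : X.X (i + 2) ⟶ W, X.d (i + 1) (i + 2) ≫ b = a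

/-- An `n`-exact sequence `X⁰ ⟶ X¹ ⟶ ⋯ ⟶ Xⁿ ⟶ Xⁿ⁺¹`. -/
structure IsNExact (n : ℕ) (X : CochainComplex C ℕ) : Prop where
  supported : SupportedUpTo (n + 1) X
  isNKernel : IsNKernel n X
  isNCokernel : IsNCokernel n X

/-- A weak isomorphism of `n`-exact sequences: a morphism `f` of complexes such that `fᵏ` and `fᵏ⁺¹`
are isomorphisms for some `k ∈ {0, …, n + 1}`, where `n + 2` is read as `0`. -/
def IsWeakIso (n : ℕ) {X Y : CochainComplex C ℕ} (f : X ⟶ Y) : Prop :=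
  (∃ k, k ≤ n ∧ IsIso (f.f k) ∧ IsIso (f.f (k + 1))) ∨ (IsIso (f.f (n + 1)) ∧ IsIso (f.f 0))

/-- The complex `X¹ ⟶ X² ⟶ ⋯`, reindexed to start in degree `0`. -/
def tail (X : CochainComplex C ℕ) : CochainComplex C ℕ where
  X i := X.X (i + 1)
  d i j := X.d (i + 1) (j + 1)
  shape i j h := X.shape _ _ (fun h' => h (by simpa using h'))

section Truncation

variable [HasZeroObject C]

open scoped ZeroObject

/-- The terms of the complex `X⁰ ⟶ ⋯ ⟶ Xᵐ` obtained from `X` by forgetting the terms of degrees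
`> m`. -/
noncomputable def truncX (m : ℕ) (X : CochainComplex C ℕ) (i : ℕ) : C :=
  if i ≤ m then X.X i else 0

/-- Up to degree `m`, the terms of the truncation are those of `X`. -/
noncomputable def truncIso (m : ℕ) (X : CochainComplex C ℕ) (i : ℕ) (h : i ≤ m) :
    truncX m X i ≅ X.X i :=
  eqToIso (if_pos h)

/-- The complex `X⁰ ⟶ ⋯ ⟶ Xᵐ` obtained from `X` by forgetting the terms of degrees `> m`
(brutal truncation). -/
noncomputable def trunc (m : ℕ) (X : CochainComplex C ℕ) : CochainComplex C ℕ where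
  X i := truncX m X i
  d i j :=
    if h : i ≤ m ∧ j ≤ m then (truncIso m X i h.1).hom ≫ X.d i j ≫ (truncIso m X j h.2).inv
    else 0
  shape i j h := by
    split_ifs
    · rw [X.shape _ _ h, zero_comp, comp_zero]
    · rfl
  d_comp_d' i j k _ _ := by
    split_ifs <;> simp

end Truncation

section Cone

variable [HasBinaryBiproducts C] {X Y : CochainComplex C ℕ}

/-- The terms `X⁰, X¹ ⊞ Y⁰, X² ⊞ Y¹, …` of the mapping cone. -/
noncomputable def coneX (X Y : CochainComplex C ℕ) : ℕ → C
  | 0 => X.X 0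
  | i + 1 => X.X (i + 1) ⊞ Y.X i

/-- The differentials of the mapping cone, with matrices `(-d, f)` in degree `0` and
`((-d, 0), (f, d))` in the other degrees. -/
noncomputable def coneD (f : X ⟶ Y) : ∀ i : ℕ, coneX X Y i ⟶ coneX X Y (i + 1)
  | 0 => biprod.lift (-X.d 0 1) (f.f 0)
  | i + 1 => biprod.desc (biprod.lift (-X.d (i + 1) (i + 2)) (f.f (i + 1)))
      (biprod.lift 0 (Y.d i (i + 1)))

theorem coneD_comp (f : X ⟶ Y) (i : ℕ) : coneD f i ≫ coneD f (i + 1) = 0 := by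
  cases i with
  | zero =>
    change biprod.lift (-X.d 0 1) (f.f 0) ≫ biprod.desc (biprod.lift (-X.d 1 2) (f.f 1))
      (biprod.lift 0 (Y.d 0 1)) = (0 : X.X 0 ⟶ X.X 2 ⊞ Y.X 1)
    ext <;> simp
  | succ i =>
    change biprod.desc (biprod.lift (-X.d (i + 1) (i + 2)) (f.f (i + 1)))
      (biprod.lift 0 (Y.d i (i + 1))) ≫ biprod.desc (biprod.lift (-X.d (i + 2) (i + 3))
      (f.f (i + 2))) (biprod.lift 0 (Y.d (i + 1) (i + 2))) =
      (0 : X.X (i + 1) ⊞ Y.X i ⟶ X.X (i + 3) ⊞ Y.X (i + 2))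
    ext <;> simp

/-- The mapping cone `X⁰ ⟶ X¹ ⊞ Y⁰ ⟶ X² ⊞ Y¹ ⟶ ⋯` of a morphism of complexes. The degrees are raised
by one, so that it starts in degree `0`. If `X` and `Y` are complexes `X⁰ ⟶ ⋯ ⟶ Xⁿ` and
`Y⁰ ⟶ ⋯ ⟶ Yⁿ`, it ends with `Xⁿ⁺¹ ⊞ Yⁿ`, where `Xⁿ⁺¹` is zero. -/
noncomputable def cone (f : X ⟶ Y) : CochainComplex C ℕ :=
  CochainComplex.of (coneX X Y) (coneD f) (coneD_comp f)

theorem cone_d (f : X ⟶ Y) (i : ℕ) : (cone f).d i (i + 1) = coneD f i :=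
  CochainComplex.of_d (coneX X Y) (coneD f) i

/-- `f` is an `n`-pushout diagram of `X⁰ ⟶ ⋯ ⟶ Xⁿ` along `f⁰ : X⁰ ⟶ Y⁰`. -/
structure IsNPushout (n : ℕ) (f : X ⟶ Y) : Prop where
  supported_left : SupportedUpTo n X
  supported_right : SupportedUpTo n Y
  isNCokernel : IsNCokernel n (cone f)

/-- `f` is an `n`-pullback diagram of `Y⁰ ⟶ ⋯ ⟶ Yⁿ` along `fⁿ : Xⁿ ⟶ Yⁿ`. -/
structure IsNPullback (n : ℕ) (f : X ⟶ Y) : Prop where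
  supported_left : SupportedUpTo n X
  supported_right : SupportedUpTo n Y
  isNKernel : IsNKernel n (cone f)

end Cone

/-- `f` is the first morphism of a complex in the class `𝒳`, up to isomorphism. -/
def IsAdmMono (𝒳 : Set (CochainComplex C ℕ)) {A B : C} (f : A ⟶ B) : Prop :=
  ∃ X ∈ 𝒳, Nonempty (Arrow.mk f ≅ Arrow.mk (X.d 0 1))

/-- `f` is the last morphism `Xⁿ ⟶ Xⁿ⁺¹` of a complex in the class `𝒳`, up to isomorphism. -/
def IsAdmEpi (n : ℕ) (𝒳 : Set (CochainComplex C ℕ)) {A B : C} (f : A ⟶ B) : Prop :=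
  ∃ X ∈ 𝒳, Nonempty (Arrow.mk f ≅ Arrow.mk (X.d n (n + 1)))

/-- `f` lies in the Jacobson radical of the category. -/
def InRad {A B : C} (f : A ⟶ B) : Prop :=
  ∀ g : B ⟶ A, IsIso (𝟙 A - f ≫ g)

/-- Left almost split morphisms. -/
def IsLeftAlmostSplit {A B : C} (f : A ⟶ B) : Prop :=
  ¬ IsSplitMono f ∧ ∀ (Z : C) (h : A ⟶ Z), ¬ IsSplitMono h → ∃ h' : B ⟶ Z, f ≫ h' = h

/-- Right almost split morphisms. -/
def IsRightAlmostSplit {A B : C} (f : A ⟶ B) : Prop :=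
  ¬ IsSplitEpi f ∧ ∀ (Z : C) (h : Z ⟶ B), ¬ IsSplitEpi h → ∃ h' : Z ⟶ A, h' ≫ f = h

variable (C) in
/-- Krull–Schmidt categories: each object is a finite direct sum of objects whose endomorphism rings
are local. -/
def IsKrullSchmidt : Prop :=
  ∀ X : C, ∃ (m : ℕ) (F : Fin m → C) (b : Bicone F),
    Nonempty b.IsBilimit ∧ Nonempty (X ≅ b.pt) ∧ ∀ i, IsLocalRing (End (F i))

variable (C) in
/-- Locally finite categories: for each indecomposable `X` there are, up to isomorphism, only
finitely many indecomposables `Y` with `Hom(X, Y) ≠ 0`, and only finitely many with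
`Hom(Y, X) ≠ 0`. -/
def IsLocallyFinite [HasBinaryBiproducts C] : Prop :=
  ∀ X : C, Indecomposable X →
    {q : Quotient (isIsomorphicSetoid C) | ∃ Y : C, Quotient.mk _ Y = q ∧ Indecomposable Y ∧
      ∃ f : X ⟶ Y, f ≠ 0}.Finite ∧
    {q : Quotient (isIsomorphicSetoid C) | ∃ Y : C, Quotient.mk _ Y = q ∧ Indecomposable Y ∧
      ∃ f : Y ⟶ X, f ≠ 0}.Finite

end Basic

/-- An `n`-exact structure in the sense of Jasso on an additive category `C`. The members of `adm`
are the admissible `n`-exact sequences. -/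
structure NExactStructure (C : Type u) [Category.{v} C] [Preadditive C] [HasZeroObject C]
    [HasBinaryBiproducts C] (n : ℕ) where
  adm : Set (CochainComplex C ℕ)
  isNExact : ∀ X ∈ adm, IsNExact n X
  /-- The class is closed under weak isomorphisms. -/
  weakIso_closed : ∀ (X Y : CochainComplex C ℕ) (f : X ⟶ Y), IsNExact n X → IsNExact n Y →
    IsWeakIso n f → (X ∈ adm ↔ Y ∈ adm)
  /-- (E0) -/
  zero_mem : ∀ X : CochainComplex C ℕ, IsZero X → X ∈ adm
  /-- (E1) -/
  mono_comp : ∀ {A B D : C} (f : A ⟶ B) (g : B ⟶ D), IsAdmMono adm f → IsAdmMono adm g →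
    IsAdmMono adm (f ≫ g)
  /-- (E1ᵒᵖ) -/
  epi_comp : ∀ {A B D : C} (f : A ⟶ B) (g : B ⟶ D), IsAdmEpi n adm f → IsAdmEpi n adm g →
    IsAdmEpi n adm (f ≫ g)
  /-- (E2): each `X` in `adm` and `g : X⁰ ⟶ A` admit an `n`-pushout diagram of `X⁰ ⟶ ⋯ ⟶ Xⁿ` along
  `g` whose first morphism `A ⟶ Y¹` is an admissible monomorphism. -/
  exists_nPushout : ∀ X ∈ adm, ∀ (A : C) (g : X.X 0 ⟶ A),
    ∃ (Y : CochainComplex C ℕ) (f : trunc n X ⟶ Y) (e : A ≅ Y.X 0),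
      IsNPushout n f ∧ f.f 0 = (truncIso n X 0 (Nat.zero_le n)).hom ≫ g ≫ e.hom ∧
        IsAdmMono adm (Y.d 0 1)
  /-- (E2ᵒᵖ): each `X` in `adm` and `g : A ⟶ Xⁿ⁺¹` admit an `n`-pullback diagram of
  `X¹ ⟶ ⋯ ⟶ Xⁿ⁺¹` along `g` whose last morphism to `A` is an admissible epimorphism. (The complexes
  are reindexed to live in the degrees `0, …, n`.) -/
  exists_nPullback : ∀ X ∈ adm, ∀ (A : C) (g : A ⟶ X.X (n + 1)),
    ∃ (Y : CochainComplex C ℕ) (f : Y ⟶ tail X) (e : Y.X n ≅ A),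
      IsNPullback n f ∧ f.f n = e.hom ≫ g ∧ IsAdmEpi n adm (Y.d (n - 1) n)

namespace NExactStructure

variable {C : Type u} [Category.{v} C] [Preadditive C] [HasZeroObject C] [HasBinaryBiproducts C]
  {n : ℕ} (E : NExactStructure C n)

/-- `P` is projective: morphisms from `P` lift along all admissible epimorphisms `Xⁿ ⟶ Xⁿ⁺¹`. -/
def IsProjective (P : C) : Prop :=
  ∀ X ∈ E.adm, ∀ c : P ⟶ X.X (n + 1), ∃ b : P ⟶ X.X n, b ≫ X.d n (n + 1) = c

/-- `I` is injective: morphisms to `I` extend along all admissible monomorphisms `X⁰ ⟶ X¹`. -/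
def IsInjective (I : C) : Prop :=
  ∀ X ∈ E.adm, ∀ c : X.X 0 ⟶ I, ∃ b : X.X 1 ⟶ I, X.d 0 1 ≫ b = c

/-- An `n`-Auslander–Reiten sequence. -/
structure IsAuslanderReitenSequence (X : CochainComplex C ℕ) : Prop where
  mem_adm : X ∈ E.adm
  isLeftAlmostSplit : IsLeftAlmostSplit (X.d 0 1)
  isRightAlmostSplit : IsRightAlmostSplit (X.d n (n + 1))
  inRad : ∀ i, 1 ≤ i → i < n → InRad (X.d i (i + 1))

/-- The `n`-exact category has `n`-Auslander–Reiten sequences: one ending at each indecomposable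
non-projective object, and one starting at each indecomposable non-injective object. -/
def HasAuslanderReitenSequences : Prop :=
  (∀ A : C, Indecomposable A → ¬ E.IsProjective A →
    ∃ X, E.IsAuslanderReitenSequence X ∧ Nonempty (X.X (n + 1) ≅ A)) ∧
  (∀ B : C, Indecomposable B → ¬ E.IsInjective B →
    ∃ X, E.IsAuslanderReitenSequence X ∧ Nonempty (X.X 0 ≅ B))

end NExactStructure

end HigherExact

namespace HigherExact

section KrullSchmidt

variable {C : Type u} [Category.{v} C] [Preadditive C]

theorem isIso_or_isIso_one_sub {X : C} (hX : IsLocalRing (End X)) (a : X ⟶ X) :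
    IsIso a ∨ IsIso (𝟙 X - a) := by
  let b : End X := 𝟙 X - (show X ⟶ X from a)
  have := hX.isUnit_or_isUnit_of_add_one (a := (show End X from a)) (b := b)
    (add_sub_cancel (show X ⟶ X from a) (𝟙 X))
  exact this.imp (isUnit_iff_isIso (C := C) _).1 (isUnit_iff_isIso (C := C) _).1

theorem isLocalRing_end_of_isIso {X : C} (hX : 𝟙 X ≠ 0)
    (h : ∀ a : X ⟶ X, IsIso a ∨ IsIso (𝟙 X - a)) : IsLocalRing (End X) := by
  have : Nontrivial (End X) := ⟨⟨𝟙 X, 0, hX⟩⟩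
  refine ⟨fun {a b} hab => ?_⟩
  have hb : b = 𝟙 X - (show X ⟶ X from a) :=
    eq_sub_of_add_eq' (show (show X ⟶ X from a) + (show X ⟶ X from b) = 𝟙 X from hab)
  subst hb
  exact (h a).imp (isUnit_iff_isIso (C := C) _).2 (isUnit_iff_isIso (C := C) _).2

theorem id_ne_zero_of_isLocalRing {X : C} (hX : IsLocalRing (End X)) : 𝟙 X ≠ 0 :=
  one_ne_zero (α := End X)

theorem isIso_of_isSplitMono_of_isLocalRing {F G : C} (hF : IsLocalRing (End F))
    (hG : IsLocalRing (End G)) (s : F ⟶ G) (r : G ⟶ F) (h : s ≫ r = 𝟙 F) : IsIso s := by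
  rcases isIso_or_isIso_one_sub hG (r ≫ s) with hi | hi
  · refine ⟨r, h, ?_⟩
    rw [← cancel_mono (r ≫ s)]
    simp [reassoc_of% h]
  · have : s ≫ (𝟙 G - r ≫ s) = 0 := by simp [reassoc_of% h]
    have hs : s = 0 := by simpa using (cancel_mono (𝟙 G - r ≫ s)).1 (this.trans zero_comp.symm)
    exact absurd (by rw [← h, hs, zero_comp]) (id_ne_zero_of_isLocalRing hF)

/-- Two complementary retracts of `X`, with terms `F` and `T`, exhibit `X` as `F ⊞ T`. -/
noncomputable def isoBiprodOfSplitting [HasBinaryBiproducts C] {X F T : C} {i : F ⟶ X} {p : X ⟶ F}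
    {a : T ⟶ X} {b : X ⟶ T} (hip : i ≫ p = 𝟙 F) (hab : a ≫ b = 𝟙 T)
    (hba : b ≫ a = 𝟙 X - p ≫ i) : X ≅ F ⊞ T where
  hom := biprod.lift p b
  inv := biprod.desc i a
  hom_inv_id := by simp [hba]
  inv_hom_id := by
    have h1 : a ≫ p = 0 := by
      have : a ≫ b ≫ a ≫ p = 0 := by rw [reassoc_of% hba]; simp [hip]
      simpa [reassoc_of% hab] using this
    have h2 : i ≫ b = 0 := by
      have : i ≫ (b ≫ a) ≫ b = 0 := by rw [hba]; simp [reassoc_of% hip]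
      simpa [hab] using this
    ext <;> simp [hip, hab, h1, h2]

theorem indecomposable_of_isLocalRing [HasBinaryBiproducts C] {X : C}
    (hX : IsLocalRing (End X)) : Indecomposable X := by
  refine ⟨fun h => id_ne_zero_of_isLocalRing hX (h.eq_of_src _ _), fun Y Z e => ?_⟩
  rcases isIso_or_isIso_one_sub hX (e.hom ≫ biprod.fst ≫ biprod.inl ≫ e.inv) with hi | hi
  · right
    have : (biprod.inr ≫ e.inv) ≫ (e.hom ≫ biprod.fst ≫ biprod.inl ≫ e.inv) = 0 := by simp
    have h0 : (biprod.inr : Z ⟶ Y ⊞ Z) ≫ e.inv = 0 :=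
      (cancel_mono _).1 (this.trans zero_comp.symm)
    rw [IsZero.iff_id_eq_zero]
    have : (biprod.inr ≫ e.inv) ≫ e.hom ≫ biprod.snd = 𝟙 Z := by simp
    rw [← this, h0, zero_comp]
  · left
    have : (biprod.inl ≫ e.inv) ≫ (𝟙 X - e.hom ≫ biprod.fst ≫ biprod.inl ≫ e.inv) = 0 := by
      simp
    have h0 : (biprod.inl : Y ⟶ Y ⊞ Z) ≫ e.inv = 0 :=
      (cancel_mono _).1 (this.trans zero_comp.symm)
    rw [IsZero.iff_id_eq_zero]
    have : (biprod.inl ≫ e.inv) ≫ e.hom ≫ biprod.fst = 𝟙 Y := by simp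
    rw [← this, h0, zero_comp]

/-- A decomposition of `X` into finitely many objects with local endomorphism rings. -/
structure LocalDecomposition (X : C) where
  m : ℕ
  F : Fin m → C
  i : ∀ j, F j ⟶ X
  p : ∀ j, X ⟶ F j
  i_p_self : ∀ j, i j ≫ p j = 𝟙 (F j)
  i_p_ne : ∀ j l, j ≠ l → i j ≫ p l = 0
  total : ∑ j, p j ≫ i j = 𝟙 X
  isLocal : ∀ j, IsLocalRing (End (F j))

theorem IsKrullSchmidt.nonempty_localDecomposition (h : IsKrullSchmidt C) (X : C) :
    Nonempty (LocalDecomposition X) := by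
  obtain ⟨m, F, b, ⟨hb⟩, ⟨e⟩, hF⟩ := h X
  refine ⟨⟨m, F, fun j => b.ι j ≫ e.inv, fun j => e.hom ≫ b.π j, fun j => by simp,
    fun j l hjl => by simp [bicone_ι_π_ne b hjl], ?_, hF⟩⟩
  have := congrArg (fun t => e.hom ≫ t ≫ e.inv) (IsBilimit.total hb)
  simpa [Preadditive.sum_comp, Preadditive.comp_sum] using this

namespace LocalDecomposition

variable {X : C} (D : LocalDecomposition X)

theorem exists_complement [HasZeroObject C] [HasBinaryBiproducts C] (j : Fin D.m) :
    ∃ (T : C) (a : T ⟶ X) (b : X ⟶ T), a ≫ b = 𝟙 T ∧ b ≫ a = 𝟙 X - D.p j ≫ D.i j := by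
  have : HasFiniteProducts C := hasFiniteProducts_of_has_binary_and_terminal
  have : HasFiniteBiproducts C := HasFiniteBiproducts.of_hasFiniteProducts
  refine ⟨⨁ (fun l : {l // l ≠ j} => D.F l), biproduct.desc (fun l => D.i l),
    biproduct.lift (fun l => D.p l), ?_, ?_⟩
  · refine biproduct.hom_ext' _ _ (fun l => biproduct.hom_ext _ _ (fun l' => ?_))
    by_cases hl : l = l'
    · subst hl; simp [D.i_p_self]
    · have : (l : Fin D.m) ≠ l' := fun h => hl (Subtype.ext h)
      simp [biproduct.ι_π_ne _ hl, D.i_p_ne _ _ this]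
  · rw [biproduct.lift_desc, ← D.total, eq_sub_iff_add_eq]
    rw [← Finset.sum_erase_add _ _ (Finset.mem_univ j)]
    congr 1
    exact (Finset.sum_subtype _ (by simp) (fun l => D.p l ≫ D.i l)).symm

end LocalDecomposition

theorem IsKrullSchmidt.isLocalRing_end [HasZeroObject C] [HasBinaryBiproducts C]
    (h : IsKrullSchmidt C) {X : C} (hX : Indecomposable X) : IsLocalRing (End X) := by
  obtain ⟨D⟩ := h.nonempty_localDecomposition X
  have h1 : 𝟙 X ≠ 0 := fun h => hX.1 ((IsZero.iff_id_eq_zero X).2 h)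
  have hm : 0 < D.m := by
    by_contra hm
    have : IsEmpty (Fin D.m) := by
      rw [Nat.eq_zero_of_not_pos hm]; infer_instance
    exact h1 (by rw [← D.total, Finset.univ_eq_empty, Finset.sum_empty])
  let j : Fin D.m := ⟨0, hm⟩
  obtain ⟨T, a, b, hab, hba⟩ := D.exists_complement j
  rcases hX.2 _ _ (isoBiprodOfSplitting (D.i_p_self j) hab hba) with h0 | h0
  · exact absurd (h0.eq_of_src _ _) (id_ne_zero_of_isLocalRing (D.isLocal j))
  · have hpi : D.p j ≫ D.i j = 𝟙 X := by
      rw [h0.eq_of_tgt b 0, zero_comp] at hba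
      exact (sub_eq_zero.1 hba.symm).symm
    have hip := D.i_p_self j
    refine isLocalRing_end_of_isIso h1 (fun x => ?_)
    have : IsIso (D.p j) := ⟨D.i j, hpi, hip⟩
    have : IsIso (D.i j) := ⟨D.p j, hip, hpi⟩
    refine (isIso_or_isIso_one_sub (D.isLocal j) (D.i j ≫ x ≫ D.p j)).imp (fun hi => ?_)
      (fun hi => ?_)
    · have e : x = D.p j ≫ (D.i j ≫ x ≫ D.p j) ≫ D.i j := by
        simp [hpi, reassoc_of% hpi]
      rw [e]; exact IsIso.comp_isIso' ‹_› (IsIso.comp_isIso' hi ‹_›)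
    · have e : 𝟙 X - x = D.p j ≫ (𝟙 _ - D.i j ≫ x ≫ D.p j) ≫ D.i j := by
        simp [hpi, reassoc_of% hpi]
      rw [e]; exact IsIso.comp_isIso' ‹_› (IsIso.comp_isIso' hi ‹_›)

theorem IsKrullSchmidt.exists_complement [HasZeroObject C] [HasBinaryBiproducts C]
    (h : IsKrullSchmidt C) {X F : C} (hF : IsLocalRing (End F)) (s : F ⟶ X) (r : X ⟶ F)
    (hsr : s ≫ r = 𝟙 F) :
    ∃ (T : C) (a : T ⟶ X) (b : X ⟶ T), a ≫ b = 𝟙 T ∧ b ≫ a = 𝟙 X - r ≫ s := by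
  obtain ⟨D⟩ := h.nonempty_localDecomposition X
  obtain ⟨j, hj⟩ : ∃ j, IsIso (s ≫ D.p j) := by
    by_contra! hcon
    have hrad : ∀ (t : Finset (Fin D.m)), IsIso (𝟙 F - ∑ j ∈ t, (s ≫ D.p j) ≫ D.i j ≫ r) := by
      intro t
      induction t using Finset.induction_on with
      | empty => simp only [Finset.sum_empty, sub_zero]; infer_instance
      | insert j t hj ih =>
        set x := 𝟙 F - ∑ j ∈ t, (s ≫ D.p j) ≫ D.i j ≫ r with hx
        rw [Finset.sum_insert hj, ← sub_sub, sub_right_comm, ← hx]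
        have hne : ¬ IsIso ((s ≫ D.p j) ≫ D.i j ≫ r ≫ inv x) := fun hi =>
          hcon j (isIso_of_isSplitMono_of_isLocalRing hF (D.isLocal j) _
            ((D.i j ≫ r ≫ inv x) ≫ inv ((s ≫ D.p j) ≫ D.i j ≫ r ≫ inv x)) (by
              rw [← Category.assoc]; exact IsIso.hom_inv_id _))
        have := (isIso_or_isIso_one_sub hF _).resolve_left hne
        have e : x - (s ≫ D.p j) ≫ D.i j ≫ r =
            (𝟙 F - (s ≫ D.p j) ≫ D.i j ≫ r ≫ inv x) ≫ x := by simp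
        rw [e]; infer_instance
    have h0 := hrad Finset.univ
    have e : ∑ j, (s ≫ D.p j) ≫ D.i j ≫ r = 𝟙 F := by
      have := congrArg (fun t => s ≫ t ≫ r) D.total
      simpa [Preadditive.sum_comp, Preadditive.comp_sum, hsr] using this
    rw [e, sub_self] at h0
    exact id_ne_zero_of_isLocalRing hF ((cancel_mono (0 : F ⟶ F)).1 (by simp))
  obtain ⟨T, a, b, hab, hba⟩ := D.exists_complement j
  have hip := D.i_p_self j
  have hap : a ≫ D.p j = 0 := by
    have : a ≫ b ≫ a ≫ D.p j = 0 := by rw [reassoc_of% hba]; simp [hip]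
    simpa [reassoc_of% hab] using this
  have hs : (D.p j ≫ inv (s ≫ D.p j) ≫ s) ≫ D.p j = D.p j := by simp
  refine ⟨T, a ≫ (𝟙 X - r ≫ s), (𝟙 X - D.p j ≫ inv (s ≫ D.p j) ≫ s) ≫ b, ?_, ?_⟩
  · have h1 : s ≫ (𝟙 X - D.p j ≫ inv (s ≫ D.p j) ≫ s) = 0 := by
      rw [Preadditive.comp_sub, ← Category.assoc, IsIso.hom_inv_id_assoc]; simp
    have h2 : a ≫ (𝟙 X - D.p j ≫ inv (s ≫ D.p j) ≫ s) = a := by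
      simp [reassoc_of% hap]
    have h3 : (𝟙 X - r ≫ s) ≫ (𝟙 X - D.p j ≫ inv (s ≫ D.p j) ≫ s) =
        𝟙 X - D.p j ≫ inv (s ≫ D.p j) ≫ s := by
      rw [Preadditive.sub_comp, Category.assoc, h1]; simp
    calc _ = a ≫ ((𝟙 X - r ≫ s) ≫ (𝟙 X - D.p j ≫ inv (s ≫ D.p j) ≫ s)) ≫ b := by
          simp only [Category.assoc]
      _ = _ := by rw [h3, reassoc_of% h2, hab]
  · have h4 : s ≫ (𝟙 X - r ≫ s) = 0 := by simp [reassoc_of% hsr]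
    have h5 : (𝟙 X - D.p j ≫ inv (s ≫ D.p j) ≫ s) ≫ D.p j = 0 := by
      rw [Preadditive.sub_comp, hs]; simp
    calc _ = (𝟙 X - D.p j ≫ inv (s ≫ D.p j) ≫ s) ≫ (b ≫ a) ≫ (𝟙 X - r ≫ s) := by
          simp only [Category.assoc]
      _ = (𝟙 X - D.p j ≫ inv (s ≫ D.p j) ≫ s) ≫ (𝟙 X - r ≫ s) := by
          rw [hba, ← Category.assoc, Preadditive.comp_sub _ (𝟙 X) (D.p j ≫ D.i j),
            ← Category.assoc _ (D.p j), h5]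
          simp only [zero_comp, sub_zero, Category.comp_id]
      _ = _ := by
          rw [Preadditive.sub_comp, Category.assoc, Category.assoc, h4]; simp

end KrullSchmidt

section Radical

variable {C : Type u} [Category.{v} C] [Preadditive C]

theorem isIso_one_sub_comp_comm {A B : C} (f : A ⟶ B) (g : B ⟶ A) (h : IsIso (𝟙 A - f ≫ g)) :
    IsIso (𝟙 B - g ≫ f) := by
  have h1 : f ≫ g ≫ inv (𝟙 A - f ≫ g) = inv (𝟙 A - f ≫ g) - 𝟙 A := by
    have := IsIso.hom_inv_id (𝟙 A - f ≫ g)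
    rw [Preadditive.sub_comp, Category.id_comp, Category.assoc] at this
    exact eq_sub_of_add_eq (by rw [← eq_sub_iff_add_eq']; exact this.symm)
  have h2 : inv (𝟙 A - f ≫ g) ≫ f ≫ g = inv (𝟙 A - f ≫ g) - 𝟙 A := by
    have := IsIso.inv_hom_id (𝟙 A - f ≫ g)
    rw [Preadditive.comp_sub, Category.comp_id] at this
    exact eq_sub_of_add_eq (by rw [← eq_sub_iff_add_eq']; exact this.symm)
  refine ⟨𝟙 B + g ≫ inv (𝟙 A - f ≫ g) ≫ f, ?_, ?_⟩
  · simp only [Preadditive.sub_comp, Preadditive.comp_add, Category.id_comp, Category.comp_id,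
      Category.assoc, reassoc_of% h1, Preadditive.comp_sub]
    abel
  · simp only [Preadditive.add_comp, Preadditive.comp_sub, Category.id_comp, Category.comp_id,
      Category.assoc, reassoc_of% h2, Preadditive.sub_comp]
    abel

theorem InRad.comp_left {A' A B : C} {f : A ⟶ B} (hf : InRad f) (s : A' ⟶ A) :
    InRad (s ≫ f) := fun g => by
  have := isIso_one_sub_comp_comm (f ≫ g) s (by simpa using hf (g ≫ s))
  simpa using this

theorem InRad.comp_right {A B B' : C} {f : A ⟶ B} (hf : InRad f) (t : B ⟶ B') :
    InRad (f ≫ t) := fun g => by simpa using hf (t ≫ g)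

theorem InRad.zero (A B : C) : InRad (0 : A ⟶ B) := fun g => by
  simp only [zero_comp, sub_zero]; infer_instance

theorem InRad.add {A B : C} {f f' : A ⟶ B} (hf : InRad f) (hf' : InRad f') :
    InRad (f + f') := fun g => by
  have := hf g
  have := hf'.comp_left (inv (𝟙 A - f ≫ g)) g
  have e : 𝟙 A - (f + f') ≫ g =
      (𝟙 A - f ≫ g) ≫ (𝟙 A - (inv (𝟙 A - f ≫ g) ≫ f') ≫ g) := by
    rw [Preadditive.comp_sub, Category.assoc, IsIso.hom_inv_id_assoc, Category.comp_id,
      Preadditive.add_comp, sub_sub]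
  rw [e]; infer_instance

theorem InRad.sum {A B : C} {ι : Type*} (t : Finset ι) (f : ι → (A ⟶ B))
    (hf : ∀ i ∈ t, InRad (f i)) : InRad (∑ i ∈ t, f i) := by
  classical
  induction t using Finset.induction_on with
  | empty => simpa using InRad.zero A B
  | insert i t hi ih =>
    rw [Finset.sum_insert hi]
    exact (hf i (by simp)).add (ih fun j hj => hf j (by simp [hj]))

theorem isIso_of_not_inRad {F G : C} (hF : IsLocalRing (End F)) (hG : IsLocalRing (End G))
    {f : F ⟶ G} (hf : ¬ InRad f) : IsIso f := by
  obtain ⟨g, hg⟩ := not_forall.1 hf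
  have := (isIso_or_isIso_one_sub hF (f ≫ g)).resolve_right hg
  exact isIso_of_isSplitMono_of_isLocalRing hF hG f (g ≫ inv (f ≫ g))
    (by rw [← Category.assoc]; exact IsIso.hom_inv_id _)

theorem IsKrullSchmidt.exists_of_not_inRad (h : IsKrullSchmidt C) {X Y : C} {f : X ⟶ Y}
    (hf : ¬ InRad f) :
    ∃ (F : C) (s : F ⟶ X) (r : Y ⟶ F), IsLocalRing (End F) ∧ s ≫ f ≫ r = 𝟙 F := by
  obtain ⟨D⟩ := h.nonempty_localDecomposition X
  obtain ⟨D'⟩ := h.nonempty_localDecomposition Y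
  obtain ⟨i, j, hij⟩ : ∃ i j, ¬ InRad (D.i i ≫ f ≫ D'.p j) := by
    by_contra! hcon
    apply hf
    have e : f = ∑ j, ∑ i, D.p i ≫ (D.i i ≫ f ≫ D'.p j) ≫ D'.i j := by
      have : f = (∑ i, D.p i ≫ D.i i) ≫ f ≫ (∑ j, D'.p j ≫ D'.i j) := by
        rw [D.total, D'.total]; simp
      simpa [Preadditive.sum_comp, Preadditive.comp_sum] using this
    rw [e]
    exact InRad.sum _ _ fun j _ => InRad.sum _ _ fun i _ =>
      ((hcon i j).comp_right _).comp_left _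
  have := isIso_of_not_inRad (D.isLocal i) (D'.isLocal j) hij
  exact ⟨D.F i, D.i i, D'.p j ≫ inv (D.i i ≫ f ≫ D'.p j), D.isLocal i, by
    rw [← Category.assoc, ← Category.assoc, Category.assoc (D.i i)]; exact IsIso.hom_inv_id _⟩

end Radical

section Comparison

variable {C : Type u} [Category.{v} C] [Preadditive C] {n : ℕ} {X Y : CochainComplex C ℕ}

theorem IsNCokernel.exists_hom (hX : IsNCokernel n X) (hXs : SupportedUpTo (n + 1) X)
    (f₀ : X.X 0 ⟶ Y.X 0) (f₁ : X.X 1 ⟶ Y.X 1) (w : f₀ ≫ Y.d 0 1 = X.d 0 1 ≫ f₁) :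
    ∃ f : X ⟶ Y, f.f 0 = f₀ ∧ f.f 1 = f₁ := by
  have key : ∀ (i : ℕ) (p : Σ' (f : X.X i ⟶ Y.X i) (f' : X.X (i + 1) ⟶ Y.X (i + 1)),
      f ≫ Y.d i (i + 1) = X.d i (i + 1) ≫ f'),
      ∃ f'' : X.X (i + 2) ⟶ Y.X (i + 2),
        p.2.1 ≫ Y.d (i + 1) (i + 2) = X.d (i + 1) (i + 2) ≫ f'' := by
    rintro i ⟨f, f', hf⟩
    have h0 : X.d i (i + 1) ≫ f' ≫ Y.d (i + 1) (i + 2) = 0 := by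
      rw [← reassoc_of% hf]; simp
    rcases lt_trichotomy i n with hi | rfl | hi
    · obtain ⟨b, hb⟩ := hX.exact i hi _ _ h0
      exact ⟨b, hb.symm⟩
    · exact ⟨0, by simpa using hX.eq_zero _ _ h0⟩
    · exact ⟨0, (hXs (i + 1) (by omega)).eq_of_src _ _⟩
  exact ⟨CochainComplex.mkHom X Y f₀ f₁ w fun i p => ⟨_, (key i p).choose_spec⟩,
    CochainComplex.mkHom_f_0 .., CochainComplex.mkHom_f_1 ..⟩

theorem IsNKernel.exists_hom (hY : IsNKernel n Y) (hYs : SupportedUpTo (n + 1) Y)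
    (f₀ : X.X n ⟶ Y.X n) (f₁ : X.X (n + 1) ⟶ Y.X (n + 1))
    (w : f₀ ≫ Y.d n (n + 1) = X.d n (n + 1) ≫ f₁) :
    ∃ f : X ⟶ Y, f.f n = f₀ ∧ f.f (n + 1) = f₁ := by
  have key : ∀ m, m ≤ n → ∃ φ : ∀ i, X.X i ⟶ Y.X i, φ n = f₀ ∧ φ (n + 1) = f₁ ∧
      ∀ i, n ≤ i + m → φ i ≫ Y.d i (i + 1) = X.d i (i + 1) ≫ φ (i + 1) := by
    intro m
    induction m with
    | zero =>
      intro _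
      refine ⟨Function.update (Function.update (fun _ => 0) n f₀) (n + 1) f₁, ?_, ?_, ?_⟩
      · rw [Function.update_of_ne (by omega), Function.update_self]
      · rw [Function.update_self]
      · intro i hi
        rcases (show n ≤ i from hi).eq_or_lt with rfl | hi
        · rw [Function.update_of_ne (by omega), Function.update_self, Function.update_self, w]
        · exact (hYs (i + 1) (by omega)).eq_of_tgt _ _
    | succ m ih =>
      intro hm
      obtain ⟨φ, h0, h1, hφ⟩ := ih (by omega)
      obtain ⟨i, rfl⟩ : ∃ i, n = i + (m + 1) := ⟨n - (m + 1), by omega⟩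
      obtain ⟨b, hb⟩ := hY.exact i (by omega) _ (X.d i (i + 1) ≫ φ (i + 1)) (by
        rw [Category.assoc, hφ (i + 1) (by omega)]; simp)
      refine ⟨Function.update φ i b, ?_, ?_, ?_⟩
      · rw [Function.update_of_ne (by omega), h0]
      · rw [Function.update_of_ne (by omega), h1]
      · intro j hj
        rcases (show i ≤ j by omega).eq_or_lt with rfl | hij
        · rw [Function.update_self, Function.update_of_ne (by omega), hb]
        · rw [Function.update_of_ne (by omega), Function.update_of_ne (by omega),
            hφ j (by omega)]
  obtain ⟨φ, h0, h1, hφ⟩ := key n le_rfl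
  refine ⟨{ f := φ, comm' := ?_ }, h0, h1⟩
  rintro i j (rfl : i + 1 = j)
  exact hφ i (by omega)

theorem IsNCokernel.exists_homotopy_aux (hX : IsNCokernel n X) (f : X ⟶ Y)
    (h₀ : X.X 1 ⟶ Y.X 0) (w : f.f 0 = X.d 0 1 ≫ h₀) (j : ℕ) (hj : j ≤ n) :
    ∃ h : X.X (j + 1) ⟶ Y.X j, X.d j (j + 1) ≫ (f.f (j + 1) - h ≫ Y.d j (j + 1)) = 0 := by
  induction j with
  | zero => exact ⟨h₀, by simp [← f.comm, w]⟩
  | succ j ih =>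
    obtain ⟨h, hh⟩ := ih (by omega)
    obtain ⟨h', hh'⟩ := hX.exact j (by omega) _ _ hh
    refine ⟨h', ?_⟩
    rw [Preadditive.comp_sub, reassoc_of% hh']
    simp

theorem IsNCokernel.exists_homotopy (hX : IsNCokernel n X) (f : X ⟶ Y)
    (h₀ : X.X 1 ⟶ Y.X 0) (w : f.f 0 = X.d 0 1 ≫ h₀) (j : ℕ) (hj : j < n) :
    ∃ (h : X.X (j + 1) ⟶ Y.X j) (h' : X.X (j + 2) ⟶ Y.X (j + 1)),
      f.f (j + 1) = X.d (j + 1) (j + 2) ≫ h' + h ≫ Y.d j (j + 1) := by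
  obtain ⟨h, hh⟩ := hX.exists_homotopy_aux f h₀ w j hj.le
  obtain ⟨h', hh'⟩ := hX.exact j hj _ _ hh
  exact ⟨h, h', by rw [hh']; abel⟩

/-- A chain map whose first component factors through `d⁰` has a last component that factors
through `dⁿ`. -/
theorem IsNCokernel.exists_last_factor (hX : IsNCokernel n X) (f : X ⟶ Y)
    (h₀ : X.X 1 ⟶ Y.X 0) (w : f.f 0 = X.d 0 1 ≫ h₀) :
    ∃ h : X.X (n + 1) ⟶ Y.X n, f.f (n + 1) = h ≫ Y.d n (n + 1) := by
  obtain ⟨h, hh⟩ := hX.exists_homotopy_aux f h₀ w n le_rfl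
  exact ⟨h, sub_eq_zero.1 (hX.eq_zero _ _ hh)⟩

theorem IsNKernel.exists_homotopy_aux (hY : IsNKernel n Y) (f : X ⟶ Y)
    (h₀ : X.X (n + 1) ⟶ Y.X n) (w : f.f (n + 1) = h₀ ≫ Y.d n (n + 1)) (j : ℕ) (hj : j ≤ n) :
    ∃ h : X.X (j + 1) ⟶ Y.X j, (f.f j - X.d j (j + 1) ≫ h) ≫ Y.d j (j + 1) = 0 := by
  induction hj using Nat.decreasingInduction with
  | self => exact ⟨h₀, by simp [w]⟩
  | of_succ j hj ih =>
    obtain ⟨h, hh⟩ := ih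
    obtain ⟨h', hh'⟩ := hY.exact j (by omega) _ _ hh
    refine ⟨h', ?_⟩
    rw [Preadditive.sub_comp, Category.assoc, hh']
    simp

theorem IsNKernel.exists_homotopy (hY : IsNKernel n Y) (f : X ⟶ Y)
    (h₀ : X.X (n + 1) ⟶ Y.X n) (w : f.f (n + 1) = h₀ ≫ Y.d n (n + 1)) (j : ℕ) (hj : j < n) :
    ∃ (h : X.X (j + 1) ⟶ Y.X j) (h' : X.X (j + 2) ⟶ Y.X (j + 1)),
      f.f (j + 1) = X.d (j + 1) (j + 2) ≫ h' + h ≫ Y.d j (j + 1) := by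
  obtain ⟨h', hh'⟩ := hY.exists_homotopy_aux f h₀ w (j + 1) hj
  obtain ⟨h, hh⟩ := hY.exact j hj _ _ hh'
  exact ⟨h, h', by rw [hh]; abel⟩

/-- A chain map whose last component factors through `dⁿ` has a first component that factors
through `d⁰`. -/
theorem IsNKernel.exists_first_factor (hY : IsNKernel n Y) (f : X ⟶ Y)
    (h₀ : X.X (n + 1) ⟶ Y.X n) (w : f.f (n + 1) = h₀ ≫ Y.d n (n + 1)) :
    ∃ h : X.X 1 ⟶ Y.X 0, f.f 0 = X.d 0 1 ≫ h := by
  obtain ⟨h, hh⟩ := hY.exists_homotopy_aux f h₀ w 0 (Nat.zero_le n)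
  exact ⟨h, sub_eq_zero.1 (hY.eq_zero _ _ hh)⟩

theorem IsNCokernel.isSplitEpi (hX : IsNCokernel n X) (h : IsSplitMono (X.d 0 1)) :
    IsSplitEpi (X.d n (n + 1)) := by
  obtain ⟨s, hs⟩ := hX.exists_last_factor (𝟙 X) (retraction (X.d 0 1)) (by simp)
  exact ⟨⟨s, by simpa using hs.symm⟩⟩

theorem IsNKernel.isSplitMono (hX : IsNKernel n X) (h : IsSplitEpi (X.d n (n + 1))) :
    IsSplitMono (X.d 0 1) := by
  obtain ⟨s, hs⟩ := hX.exists_first_factor (𝟙 X) (section_ (X.d n (n + 1))) (by simp)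
  exact ⟨⟨s, by simpa using hs.symm⟩⟩

/-- An `n`-cokernel of the first morphism of an `n`-exact sequence gives an `n`-exact sequence. -/
theorem IsNCokernel.isNKernel_of_hom (hX : IsNKernel n X) (hY : IsNCokernel n Y)
    (hYs : SupportedUpTo (n + 1) Y) (φ : X ⟶ Y) [IsIso (φ.f 0)] [IsIso (φ.f 1)] :
    IsNKernel n Y := by
  obtain ⟨ψ, h0, h1⟩ := hY.exists_hom hYs (inv (φ.f 0)) (inv (φ.f 1))
    (by rw [IsIso.inv_comp_eq, ← Category.assoc, φ.comm]; simp)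
  constructor
  · intro W a ha
    have : (a ≫ inv (φ.f 0)) ≫ X.d 0 1 = 0 := by
      rw [Category.assoc, ← h0, ψ.comm, reassoc_of% ha, zero_comp]
    have := hX.eq_zero _ _ this
    simpa using congrArg (· ≫ φ.f 0) this
  · intro i hi W a ha
    obtain ⟨b, hb⟩ := hX.exact i hi _ (a ≫ ψ.f (i + 1)) (by
      rw [Category.assoc, ψ.comm, reassoc_of% ha, zero_comp])
    obtain ⟨h, h', hh⟩ := hY.exists_homotopy (𝟙 Y - ψ ≫ φ) 0 (by simp [h0]) i hi
    refine ⟨b ≫ φ.f i + a ≫ h, ?_⟩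
    have e : a ≫ (𝟙 Y - ψ ≫ φ).f (i + 1) = a ≫ h ≫ Y.d i (i + 1) := by
      rw [hh, Preadditive.comp_add, reassoc_of% ha]; simp
    simp only [HomologicalComplex.sub_f_apply, HomologicalComplex.id_f,
      HomologicalComplex.comp_f, Preadditive.comp_sub, Category.comp_id] at e
    rw [Preadditive.add_comp, Category.assoc, Category.assoc, ← e, φ.comm, reassoc_of% hb]
    abel

/-- An `n`-kernel of the last morphism of an `n`-exact sequence gives an `n`-exact sequence. -/
theorem IsNKernel.isNCokernel_of_hom (hX : IsNCokernel n X) (hY : IsNKernel n Y)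
    (hYs : SupportedUpTo (n + 1) Y) (φ : Y ⟶ X)
    [IsIso (φ.f n)] [IsIso (φ.f (n + 1))] : IsNCokernel n Y := by
  obtain ⟨ψ, h0, h1⟩ := hY.exists_hom hYs (inv (φ.f n)) (inv (φ.f (n + 1)))
    (by rw [IsIso.inv_comp_eq, ← Category.assoc, φ.comm]; simp)
  constructor
  · intro W a ha
    have : X.d n (n + 1) ≫ inv (φ.f (n + 1)) ≫ a = 0 := by
      rw [← h1, ← ψ.comm_assoc, ha, comp_zero]
    have := hX.eq_zero _ _ this
    simpa using congrArg (φ.f (n + 1) ≫ ·) this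
  · intro i hi W a ha
    obtain ⟨b, hb⟩ := hX.exact i hi _ (ψ.f (i + 1) ≫ a) (by
      rw [← ψ.comm_assoc, ha, comp_zero])
    obtain ⟨h, h', hh⟩ := hY.exists_homotopy (𝟙 Y - φ ≫ ψ) 0 (by simp [h1]) i hi
    refine ⟨φ.f (i + 2) ≫ b + h' ≫ a, ?_⟩
    have e : (𝟙 Y - φ ≫ ψ).f (i + 1) ≫ a = Y.d (i + 1) (i + 2) ≫ h' ≫ a := by
      rw [hh, Preadditive.add_comp, Category.assoc, Category.assoc, ha]; simp
    simp only [HomologicalComplex.sub_f_apply, HomologicalComplex.id_f,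
      HomologicalComplex.comp_f, Preadditive.sub_comp, Category.id_comp, Category.assoc] at e
    rw [Preadditive.comp_add, ← e, ← φ.comm_assoc, hb]
    abel

end Comparison

section Arrow

variable {C : Type u} [Category.{v} C]

theorem exists_arrow_iso {A B A' B' : C} {f : A ⟶ B} {g : A' ⟶ B'}
    (h : Nonempty (Arrow.mk f ≅ Arrow.mk g)) :
    ∃ (e : A ≅ A') (e' : B ≅ B'), e.hom ≫ g = f ≫ e'.hom := by
  obtain ⟨i⟩ := h
  exact ⟨Arrow.leftFunc.mapIso i, Arrow.rightFunc.mapIso i, i.hom.w⟩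

end Arrow

section Cone

variable {C : Type u} [Category.{v} C] [Preadditive C] [HasBinaryBiproducts C] {n : ℕ}
  {X Y : CochainComplex C ℕ} {f : X ⟶ Y}

theorem IsNPullback.eq_zero (hf : IsNPullback n f) {W : C} (a : W ⟶ X.X 0)
    (h : a ≫ X.d 0 1 = 0) (h' : a ≫ f.f 0 = 0) : a = 0 := by
  refine hf.isNKernel.eq_zero W a ?_
  rw [cone_d]
  change a ≫ biprod.lift (-X.d 0 1) (f.f 0) = (0 : W ⟶ X.X 1 ⊞ Y.X 0)
  ext <;> simp [h, h']

theorem IsNPullback.exists_lift (hf : IsNPullback n f) {i : ℕ} (hi : i < n) {W : C}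
    (a : W ⟶ X.X (i + 1)) (b : W ⟶ Y.X i) (h : a ≫ X.d (i + 1) (i + 2) = 0)
    (h' : a ≫ f.f (i + 1) = b ≫ Y.d i (i + 1)) :
    ∃ c : W ⟶ X.X i, c ≫ X.d i (i + 1) = a ∧ (i = 0 → c ≫ f.f i = b) := by
  obtain ⟨c, hc⟩ := hf.isNKernel.exact i hi W
    (biprod.lift (-a) b : W ⟶ X.X (i + 1) ⊞ Y.X i) (by
      rw [cone_d]
      change biprod.lift (-a) b ≫ biprod.desc (biprod.lift (-X.d (i + 1) (i + 2)) (f.f (i + 1)))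
        (biprod.lift 0 (Y.d i (i + 1))) = (0 : W ⟶ X.X (i + 2) ⊞ Y.X (i + 1))
      ext <;> simp [h, h'])
  rw [cone_d] at hc
  cases i with
  | zero =>
    change W ⟶ X.X 0 at c
    change c ≫ biprod.lift (-X.d 0 1) (f.f 0) = (biprod.lift (-a) b : W ⟶ X.X 1 ⊞ Y.X 0) at hc
    refine ⟨c, ?_, fun _ => ?_⟩
    · simpa using congrArg (· ≫ biprod.fst) hc
    · simpa using congrArg (· ≫ biprod.snd) hc
  | succ i =>
    change W ⟶ X.X (i + 1) ⊞ Y.X i at c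
    change c ≫ biprod.desc (biprod.lift (-X.d (i + 1) (i + 2)) (f.f (i + 1)))
        (biprod.lift 0 (Y.d i (i + 1))) =
        (biprod.lift (-a) b : W ⟶ X.X (i + 2) ⊞ Y.X (i + 1)) at hc
    refine ⟨c ≫ biprod.fst, ?_, fun h => absurd h (Nat.succ_ne_zero i)⟩
    have := congrArg (fun t => -(t ≫ biprod.fst)) hc
    have e : c = biprod.lift (c ≫ biprod.fst) (c ≫ biprod.snd) := by ext <;> simp
    rw [e] at this
    simpa using this

theorem IsNPushout.eq_zero (hn : 1 ≤ n) (hf : IsNPushout n f) {W : C} (a : Y.X n ⟶ W)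
    (h : ∀ j, j + 1 = n → Y.d j n ≫ a = 0) (h' : f.f n ≫ a = 0) : a = 0 := by
  obtain ⟨m, rfl⟩ : ∃ m, n = m + 1 := ⟨n - 1, by omega⟩
  have := hf.isNCokernel.eq_zero W (biprod.desc 0 a : X.X (m + 2) ⊞ Y.X (m + 1) ⟶ W) (by
    rw [cone_d]
    change biprod.desc (biprod.lift (-X.d (m + 1) (m + 2)) (f.f (m + 1)))
        (biprod.lift 0 (Y.d m (m + 1))) ≫ biprod.desc 0 a = (0 : X.X (m + 1) ⊞ Y.X m ⟶ W)
    ext <;> simp [h m rfl, h'])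
  change (biprod.desc 0 a : X.X (m + 2) ⊞ Y.X (m + 1) ⟶ W) = 0 at this
  simpa using congrArg (biprod.inr ≫ ·) this

theorem IsNPushout.exists_desc (hf : IsNPushout n f) {i : ℕ} (hi : i < n) {W : C}
    (a : Y.X i ⟶ W) (b : X.X (i + 1) ⟶ W) (h : ∀ j, j + 1 = i → Y.d j i ≫ a = 0)
    (h' : f.f i ≫ a = X.d i (i + 1) ≫ b) :
    ∃ c : Y.X (i + 1) ⟶ W, Y.d i (i + 1) ≫ c = a ∧ (i + 1 = n → f.f (i + 1) ≫ c = b) := by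
  obtain ⟨c, hc⟩ := hf.isNCokernel.exact i hi W
    (biprod.desc b a : X.X (i + 1) ⊞ Y.X i ⟶ W) (by
      rw [cone_d]
      cases i with
      | zero =>
        change biprod.lift (-X.d 0 1) (f.f 0) ≫ biprod.desc b a = 0
        simp [h']
      | succ i =>
        change biprod.desc (biprod.lift (-X.d (i + 1) (i + 2)) (f.f (i + 1)))
          (biprod.lift 0 (Y.d i (i + 1))) ≫ biprod.desc b a = (0 : X.X (i + 1) ⊞ Y.X i ⟶ W)
        ext <;> simp [h', h i rfl])
  rw [cone_d] at hc
  change X.X (i + 2) ⊞ Y.X (i + 1) ⟶ W at c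
  change biprod.desc (biprod.lift (-X.d (i + 1) (i + 2)) (f.f (i + 1)))
        (biprod.lift 0 (Y.d i (i + 1))) ≫ c = (biprod.desc b a : X.X (i + 1) ⊞ Y.X i ⟶ W) at hc
  have e : c = biprod.desc (biprod.inl ≫ c) (biprod.inr ≫ c) := by ext <;> simp
  rw [e] at hc
  refine ⟨biprod.inr ≫ c, ?_, fun hin => ?_⟩
  · simpa using congrArg (biprod.inr ≫ ·) hc
  · have h0 := (hf.supported_left (i + 2) (by omega)).eq_of_tgt (X.d (i + 1) (i + 2)) 0
    simpa [h0] using congrArg (biprod.inl ≫ ·) hc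

end Cone

section Augment

variable {C : Type u} [Category.{v} C] [Preadditive C] {n : ℕ}

/-- The `n`-kernel obtained by pulling back an `n`-kernel. The hypotheses on `F` are those of an
`n`-pullback diagram, written out in terms of its components. -/
theorem exists_isNKernel_augment (hn : 1 ≤ n) {X V : CochainComplex C ℕ} (hX : IsNKernel n X)
    (F : ∀ i, V.X i ⟶ X.X (i + 1))
    (hF : ∀ i, F i ≫ X.d (i + 1) (i + 2) = V.d i (i + 1) ≫ F (i + 1))
    (hzero : ∀ {W : C} (a : W ⟶ V.X 0), a ≫ V.d 0 1 = 0 → a ≫ F 0 = 0 → a = 0)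
    (hlift : ∀ {i : ℕ}, i < n → ∀ {W : C} (a : W ⟶ V.X (i + 1)) (b : W ⟶ X.X (i + 1)),
      a ≫ V.d (i + 1) (i + 2) = 0 → a ≫ F (i + 1) = b ≫ X.d (i + 1) (i + 2) →
      ∃ c : W ⟶ V.X i, c ≫ V.d i (i + 1) = a ∧ (i = 0 → c ≫ F i = b)) :
    ∃ (ι : X.X 0 ⟶ V.X 0) (w : ι ≫ V.d 0 1 = 0) (φ : CochainComplex.augment V ι w ⟶ X),
      IsNKernel n (CochainComplex.augment V ι w) ∧ IsIso (φ.f 0) ∧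
        ∀ i, φ.f (i + 1) = F i := by
  obtain ⟨ι, w, hι⟩ := hlift (i := 0) (by omega) (0 : X.X 0 ⟶ V.X 1) (X.d 0 1) zero_comp
    (by simp)
  replace hι : ι ≫ F 0 = X.d 0 1 := hι rfl
  let φ : CochainComplex.augment V ι w ⟶ X :=
    { f := fun i => match i with
        | 0 => 𝟙 (X.X 0)
        | i + 1 => F i
      comm' := by
        rintro i j (rfl : i + 1 = j)
        cases i with
        | zero => exact (Category.id_comp _).trans hι.symm
        | succ i => exact hF i }
  refine ⟨ι, w, φ, ⟨?_, ?_⟩, inferInstanceAs (IsIso (𝟙 (X.X 0))), fun _ => rfl⟩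
  · intro W a ha
    change W ⟶ X.X 0 at a
    change a ≫ ι = 0 at ha
    exact hX.eq_zero W a (by rw [← hι, reassoc_of% ha, zero_comp])
  · intro i hi W a ha
    change W ⟶ V.X i at a
    change a ≫ V.d i (i + 1) = 0 at ha
    obtain ⟨b, hb⟩ := hX.exact i hi W (a ≫ F i) (by
      rw [Category.assoc, hF, reassoc_of% ha, zero_comp])
    cases i with
    | zero =>
      refine ⟨b, ?_⟩
      change b ≫ ι = a
      rw [← sub_eq_zero]
      refine hzero _ ?_ ?_
      · rw [Preadditive.sub_comp, Category.assoc, w, ha]; simp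
      · rw [Preadditive.sub_comp, Category.assoc, hι]; exact sub_eq_zero.2 hb
    | succ i =>
      obtain ⟨c, hc, _⟩ := hlift (i := i) (by omega) a b ha hb.symm
      exact ⟨c, hc⟩

end Augment

section Pullback

variable {C : Type u} [Category.{v} C] [Preadditive C] [HasZeroObject C] [HasBinaryBiproducts C]
  {n : ℕ}

theorem NExactStructure.exists_pullback (E : NExactStructure C n) (hn : 1 ≤ n)
    {X : CochainComplex C ℕ} (hX : X ∈ E.adm) {A : C} (g : A ⟶ X.X (n + 1)) :
    ∃ V ∈ E.adm, ∃ (φ : V ⟶ X) (e : V.X (n + 1) ≅ A), φ.f (n + 1) = e.hom ≫ g ∧ IsIso (φ.f 0) ∧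
      ∀ (W : C) (h : W ⟶ A), (∃ s : W ⟶ X.X n, s ≫ X.d n (n + 1) = h ≫ g) →
        ∃ r : W ⟶ V.X n, r ≫ V.d n (n + 1) = h ≫ e.inv := by
  obtain ⟨V, f, e, hf, hfe, Z, hZ, hZV⟩ := E.exists_nPullback X hX A g
  obtain ⟨e₁, e₂, he⟩ := exists_arrow_iso hZV
  let F : ∀ i, V.X i ⟶ X.X (i + 1) := fun i => f.f i
  have hlift : ∀ {i : ℕ}, i < n → ∀ {W : C} (a : W ⟶ V.X (i + 1)) (b : W ⟶ X.X (i + 1)),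
      a ≫ V.d (i + 1) (i + 2) = 0 → a ≫ F (i + 1) = b ≫ X.d (i + 1) (i + 2) →
      ∃ c : W ⟶ V.X i, c ≫ V.d i (i + 1) = a ∧ (i = 0 → c ≫ F i = b) :=
    fun hi _ a b h h' => hf.exists_lift hi a b h h'
  obtain ⟨ι, w, φ, hV, h0, hφ⟩ := exists_isNKernel_augment hn (E.isNExact X hX).isNKernel F
    (fun i => f.comm i (i + 1)) (fun a => hf.eq_zero a) hlift
  obtain ⟨m, rfl⟩ : ∃ m, n = m + 1 := ⟨n - 1, by omega⟩
  have hVs : SupportedUpTo (m + 2) (CochainComplex.augment V ι w) := by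
    intro i hi
    obtain ⟨i, rfl⟩ : ∃ j, i = j + 1 := ⟨i - 1, by omega⟩
    exact hf.supported_left i (by omega)
  obtain ⟨ψ, hψ, hψ'⟩ := (E.isNExact Z hZ).isNKernel.exists_hom (E.isNExact Z hZ).supported
    (X := CochainComplex.augment V ι w) e₁.hom e₂.hom he
  have i1 : IsIso (ψ.f (m + 1)) := by rw [hψ]; exact e₁.isIso_hom
  have i2 : IsIso (ψ.f (m + 2)) := by rw [hψ']; exact e₂.isIso_hom
  have hV' := hV.isNCokernel_of_hom (E.isNExact Z hZ).isNCokernel hVs ψ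
  have hVadm : CochainComplex.augment V ι w ∈ E.adm :=
    (E.weakIso_closed _ _ ψ ⟨hVs, hV, hV'⟩ (E.isNExact Z hZ) (Or.inl ⟨m + 1, le_rfl, i1, i2⟩)).2 hZ
  refine ⟨_, hVadm, φ, e, (hφ _).trans hfe, h0, ?_⟩
  rintro W h ⟨s, hs⟩
  obtain ⟨c, hc, _⟩ := hlift (i := m) (by omega) (h ≫ e.inv) s
    ((hf.supported_left (m + 2) (by omega)).eq_of_tgt _ _) (by rw [show F (m + 1) = e.hom ≫ g from hfe]; simpa using hs.symm)
  exact ⟨c, hc⟩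

end Pullback

section Pushout

variable {C : Type u} [Category.{v} C] [Preadditive C]

/-- Appending a term in degree `n + 1` to a complex supported up to `n`. -/
theorem exists_append {n : ℕ} {X Y : CochainComplex C ℕ} (hX : SupportedUpTo (n + 1) X)
    (G : ∀ i, X.X i ⟶ Y.X i)
    (hG : ∀ i, i + 1 ≤ n → G i ≫ Y.d i (i + 1) = X.d i (i + 1) ≫ G (i + 1))
    (p : Y.X n ⟶ X.X (n + 1)) (hp : G n ≫ p = X.d n (n + 1))
    (hdp : ∀ j, j + 1 = n → Y.d j n ≫ p = 0) :
    ∃ (Z : CochainComplex C ℕ) (φ : X ⟶ Z) (α : ∀ i, i ≤ n → (Z.X i ≅ Y.X i))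
      (β : Z.X (n + 1) ≅ X.X (n + 1)), SupportedUpTo (n + 1) Z ∧
      (∀ i (h : i + 1 ≤ n), Z.d i (i + 1) =
        (α i (by omega)).hom ≫ Y.d i (i + 1) ≫ (α (i + 1) h).inv) ∧
      Z.d n (n + 1) = (α n le_rfl).hom ≫ p ≫ β.inv ∧
      (∀ i (h : i ≤ n), φ.f i = G i ≫ (α i h).inv) ∧ φ.f (n + 1) = β.inv := by
  let T : ℕ → C := fun i => if i ≤ n then Y.X i else X.X i
  let α : ∀ i, i ≤ n → (T i ≅ Y.X i) := fun i h => eqToIso (if_pos h)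
  let β : ∀ i, ¬ i ≤ n → (T i ≅ X.X i) := fun i h => eqToIso (if_neg h)
  let q : ∀ i, Y.X i ⟶ X.X (i + 1) := Function.update (fun _ => 0) n p
  have hq : q n = p := Function.update_self ..
  let d : ∀ i, T i ⟶ T (i + 1) := fun i =>
    if h : i + 1 ≤ n then (α i (by omega)).hom ≫ Y.d i (i + 1) ≫ (α (i + 1) h).inv
    else if h' : i ≤ n then (α i h').hom ≫ q i ≫ (β (i + 1) h).inv else 0
  have hd₁ : ∀ i (h : i + 1 ≤ n), d i =
      (α i (by omega)).hom ≫ Y.d i (i + 1) ≫ (α (i + 1) h).inv := fun i h => dif_pos h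
  have hd₂ : d n = (α n le_rfl).hom ≫ p ≫ (β (n + 1) (by omega)).inv := by
    simp only [d]
    rw [dif_neg (by omega), dif_pos le_rfl, hq]
  have hd₃ : ∀ i, n < i → d i = 0 := fun i h => by
    simp only [d]
    rw [dif_neg (by omega), dif_neg (by omega)]
  have hdd : ∀ i, d i ≫ d (i + 1) = 0 := by
    intro i
    rcases lt_trichotomy (i + 1) n with h | h | h
    · rw [hd₁ i h.le, hd₁ (i + 1) h]; simp
    · subst h
      rw [hd₁ i le_rfl, hd₂]; simp [reassoc_of% (hdp i rfl)]
    · rw [hd₃ _ h, comp_zero]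
  let φ : ∀ i, X.X i ⟶ T i := fun i =>
    if h : i ≤ n then G i ≫ (α i h).inv else (β i h).inv
  have hφ₁ : ∀ i (h : i ≤ n), φ i = G i ≫ (α i h).inv := fun i h => dif_pos h
  have hφ₂ : ∀ i (h : ¬ i ≤ n), φ i = (β i h).inv := fun i h => dif_neg h
  have hcomm : ∀ i, φ i ≫ d i = X.d i (i + 1) ≫ φ (i + 1) := by
    intro i
    rcases lt_trichotomy i n with h | rfl | h
    · rw [hφ₁ i h.le, hφ₁ (i + 1) h, hd₁ i h]
      simp [reassoc_of% (hG i h)]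
    · rw [hφ₁ i le_rfl, hφ₂ (i + 1) (by omega), hd₂]
      simp [reassoc_of% hp]
    · rw [hd₃ i h, (hX (i + 1) (by omega)).eq_of_tgt (X.d i (i + 1)) 0]
      simp
  have hof : ∀ i, (CochainComplex.of T d hdd).d i (i + 1) = d i :=
    fun i => CochainComplex.of_d T d i
  refine ⟨CochainComplex.of T d hdd,
    { f := φ, comm' := ?_ }, α, β (n + 1) (by omega), ?_, ?_, ?_, hφ₁, hφ₂ _ (by omega)⟩
  · rintro i j (rfl : i + 1 = j)
    exact (congrArg (φ i ≫ ·) (hof i)).trans (hcomm i)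
  · intro i hi
    exact (hX i hi).of_iso (β i (by omega))
  · intro i h
    exact (hof i).trans (hd₁ i h)
  · exact (hof n).trans hd₂

variable [HasZeroObject C]

theorem trunc_d (n : ℕ) (X : CochainComplex C ℕ) (i : ℕ) (h : i + 1 ≤ n) :
    (trunc n X).d i (i + 1) =
      (truncIso n X i (by omega)).hom ≫ X.d i (i + 1) ≫ (truncIso n X (i + 1) h).inv := by
  dsimp [trunc]
  rw [dif_pos ⟨by omega, h⟩]

variable [HasBinaryBiproducts C] {n : ℕ}

theorem NExactStructure.exists_pushout (E : NExactStructure C n) (hn : 1 ≤ n)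
    {X : CochainComplex C ℕ} (hX : X ∈ E.adm) {A : C} (g : X.X 0 ⟶ A) :
    ∃ Z ∈ E.adm, ∃ (φ : X ⟶ Z) (e : A ≅ Z.X 0), φ.f 0 = g ≫ e.hom ∧ IsIso (φ.f (n + 1)) ∧
      ∀ (W : C) (h : A ⟶ W), (∃ s : X.X 1 ⟶ W, X.d 0 1 ≫ s = g ≫ h) →
        ∃ r : Z.X 1 ⟶ W, Z.d 0 1 ≫ r = e.inv ≫ h := by
  obtain ⟨Y, f, e, hf, hfe, Q, hQ, hQY⟩ := E.exists_nPushout X hX A g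
  obtain ⟨e₁, e₂, he⟩ := exists_arrow_iso hQY
  have hXe := E.isNExact X hX
  let t : ∀ i, i ≤ n → ((trunc n X).X i ≅ X.X i) := truncIso n X
  have htd : ∀ i (h : i + 1 ≤ n), (t i (by omega)).inv ≫ (trunc n X).d i (i + 1) =
      X.d i (i + 1) ≫ (t (i + 1) h).inv := fun i h => by
    rw [trunc_d n X i h]; exact Iso.inv_hom_id_assoc _ _
  let G : ∀ i, X.X i ⟶ Y.X i := fun i => if h : i ≤ n then (t i h).inv ≫ f.f i else 0
  have hGe : ∀ i (h : i ≤ n), G i = (t i h).inv ≫ f.f i := fun i h => dif_pos h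
  have hGf : ∀ i (h : i ≤ n), f.f i = (t i h).hom ≫ G i := fun i h => by rw [hGe i h]; simp
  have hG : ∀ i, i + 1 ≤ n → G i ≫ Y.d i (i + 1) = X.d i (i + 1) ≫ G (i + 1) := by
    intro i h
    rw [hGe i (by omega), hGe (i + 1) h, Category.assoc, f.comm, reassoc_of% (htd i h)]
  have hlast : ∀ {W : C} (a : Y.X n ⟶ W), (∀ j, j + 1 = n → Y.d j n ≫ a = 0) → G n ≫ a = 0 →
      a = 0 := fun a h h' => hf.eq_zero hn a h (by rw [hGf n le_rfl, Category.assoc, h', comp_zero])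
  have hdesc : ∀ {i : ℕ} (_ : i < n) {W : C} (a : Y.X i ⟶ W) (b : X.X (i + 1) ⟶ W)
      (_ : ∀ j, j + 1 = i → Y.d j i ≫ a = 0) (_ : G i ≫ a = X.d i (i + 1) ≫ b),
      ∃ c : Y.X (i + 1) ⟶ W, Y.d i (i + 1) ≫ c = a ∧ (i + 1 = n → G (i + 1) ≫ c = b) := by
    intro i hi W a b h h'
    obtain ⟨c, hc, hc'⟩ := hf.exists_desc hi a ((t (i + 1) hi).hom ≫ b) h (by
      rw [hGf i hi.le, Category.assoc, h', ← cancel_epi (t i hi.le).inv, Iso.inv_hom_id_assoc,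
        reassoc_of% (htd i hi), Iso.inv_hom_id_assoc])
    refine ⟨c, hc, fun hin => ?_⟩
    have := hc' hin
    rwa [hGf (i + 1) hi, Category.assoc, cancel_epi] at this
  obtain ⟨p, hp, hdp⟩ : ∃ p : Y.X n ⟶ X.X (n + 1), G n ≫ p = X.d n (n + 1) ∧
      ∀ j, j + 1 = n → Y.d j n ≫ p = 0 := by
    obtain ⟨m, rfl⟩ : ∃ m, n = m + 1 := ⟨n - 1, by omega⟩
    obtain ⟨p, hp, hp'⟩ := hdesc (i := m) (by omega) 0 (X.d (m + 1) (m + 2)) (by simp) (by simp)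
    refine ⟨p, hp' rfl, fun j hj => ?_⟩
    obtain rfl : j = m := by omega
    exact hp
  obtain ⟨Z, φ, α, β, hZs, hZd, hZd', hφ, hφ'⟩ := exists_append hXe.supported G hG p hp hdp
  have hZ : IsNCokernel n Z := by
    constructor
    · intro W a ha
      have h1 : p ≫ β.inv ≫ a = 0 := by
        rw [hZd', Category.assoc, Category.assoc] at ha
        rw [← cancel_epi (α n le_rfl).hom, ha, comp_zero]
      have h2 := hXe.isNCokernel.eq_zero W (β.inv ≫ a) (by
        rw [← hp, Category.assoc, h1, comp_zero])
      rw [← cancel_epi β.inv, h2, comp_zero]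
    · intro i hi W a ha
      have h1 : Y.d i (i + 1) ≫ (α (i + 1) hi).inv ≫ a = 0 := by
        rw [hZd i hi, Category.assoc, Category.assoc] at ha
        rw [← cancel_epi (α i hi.le).hom, ha, comp_zero]
      obtain ⟨b, hb⟩ := hXe.isNCokernel.exact i hi W (G (i + 1) ≫ (α (i + 1) hi).inv ≫ a) (by
        rw [← Category.assoc, ← hG i hi, Category.assoc, h1, comp_zero])
      rcases (show i + 1 ≤ n from hi).eq_or_lt with rfl | hi'
      · refine ⟨β.hom ≫ b, ?_⟩
        rw [hZd', Category.assoc, Category.assoc, Iso.inv_hom_id_assoc, ← Iso.eq_inv_comp,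
          ← sub_eq_zero]
        refine hlast _ (fun j hj => ?_) ?_
        · obtain rfl : j = i := by omega
          rw [Preadditive.comp_sub, reassoc_of% (hdp j rfl), h1]; simp
        · rw [Preadditive.comp_sub, reassoc_of% hp, hb, sub_self]
      · obtain ⟨c, hc, _⟩ := hdesc (i := i + 1) hi' ((α (i + 1) hi).inv ≫ a) b (fun j hj => by
          obtain rfl : j = i := by omega
          exact h1) hb.symm
        refine ⟨(α (i + 2) hi').hom ≫ c, ?_⟩
        rw [hZd (i + 1) hi', Category.assoc, Category.assoc, Iso.inv_hom_id_assoc, hc,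
          Iso.hom_inv_id_assoc]
  obtain ⟨ψ, hψ, hψ'⟩ := (E.isNExact Q hQ).isNCokernel.exists_hom (E.isNExact Q hQ).supported
    (Y := Z) (e₁.inv ≫ (α 0 (Nat.zero_le n)).inv) (e₂.inv ≫ (α 1 hn).inv) (by
      rw [hZd 0 hn, Category.assoc, Iso.inv_hom_id_assoc, Iso.inv_comp_eq, reassoc_of% he,
        Iso.hom_inv_id_assoc])
  have i1 : IsIso (ψ.f 0) := by rw [hψ]; infer_instance
  have i2 : IsIso (ψ.f 1) := by rw [hψ']; infer_instance
  have hZ' := hZ.isNKernel_of_hom (E.isNExact Q hQ).isNKernel hZs ψ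
  have hZadm : Z ∈ E.adm :=
    (E.weakIso_closed _ _ ψ (E.isNExact Q hQ) ⟨hZs, hZ', hZ⟩
      (Or.inl ⟨0, Nat.zero_le n, i1, i2⟩)).1 hQ
  have hGg : G 0 = g ≫ e.hom := by
    rw [hGe 0 (Nat.zero_le n), hfe]; exact Iso.inv_hom_id_assoc _ _
  refine ⟨Z, hZadm, φ, e ≪≫ (α 0 (Nat.zero_le n)).symm, ?_, by rw [hφ']; infer_instance, ?_⟩
  · rw [hφ 0 (Nat.zero_le n), hGg]; simp
  · rintro W h ⟨s, hs⟩
    obtain ⟨c, hc, _⟩ := hdesc (i := 0) hn (e.inv ≫ h) s (fun j hj => by omega)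
      (by rw [hGg]; simpa using hs.symm)
    refine ⟨(α 1 hn).hom ≫ c, ?_⟩
    rw [hZd 0 hn, Category.assoc, Category.assoc, Iso.inv_hom_id_assoc, hc]
    simp

end Pushout

section Socle

variable {k : Type w} [Field k] {C : Type u} [Category.{v} C] [Preadditive C] [HasZeroObject C]
  [HasBinaryBiproducts C] [Linear k C]

/-- If `d` is not a split monomorphism, the covariant functor of morphisms out of its source modulo
those factoring through `d` has a socle element on an indecomposable object. -/
theorem exists_socle_left (hfin : ∀ X Y : C, Module.Finite k (X ⟶ Y)) (hKS : IsKrullSchmidt C)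
    (hloc : IsLocallyFinite C) {A M : C} (d : A ⟶ M) (hd : ¬ IsSplitMono d) :
    ∃ (Z : C) (g : A ⟶ Z), Indecomposable Z ∧ (¬ ∃ s, d ≫ s = g) ∧
      ∀ (W : C) (w : Z ⟶ W), ¬ IsSplitMono w → ∃ s, d ≫ s = g ≫ w := by
  obtain ⟨B, g, hB, hg⟩ : ∃ (B : C) (g : A ⟶ B), Indecomposable B ∧ ¬ ∃ s, d ≫ s = g := by
    by_contra! hcon
    obtain ⟨D⟩ := hKS.nonempty_localDecomposition A
    choose s hs using fun j => hcon _ (D.p j) (indecomposable_of_isLocalRing (D.isLocal j))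
    refine hd ⟨⟨∑ j, s j ≫ D.i j, ?_⟩⟩
    rw [Preadditive.comp_sum, ← D.total]
    simp [reassoc_of% hs]
  let S := {q : Quotient (isIsomorphicSetoid C) | ∃ Y : C, Quotient.mk _ Y = q ∧
    Indecomposable Y ∧ ∃ f : B ⟶ Y, f ≠ 0}
  have : Finite S := (hloc B hB).1.to_subtype
  let V := ∀ q : S, (A ⟶ Quotient.out q.1)
  let N : ∀ {Z : C}, (B ⟶ Z) → Submodule k V := fun {Z} h =>
    Submodule.pi Set.univ (fun q => LinearMap.range (Linear.leftComp k (Quotient.out q.1) (g ≫ h)) ⊔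
      LinearMap.range (Linear.leftComp k (Quotient.out q.1) d))
  have hN : ∀ {Z : C} (h : B ⟶ Z) (φ : V), φ ∈ N h ↔
      ∀ q, ∃ c s, (g ≫ h) ≫ c + d ≫ s = φ q := by
    intro Z h φ
    refine Submodule.mem_pi.trans ?_
    simp [Submodule.mem_sup]
  obtain ⟨_, ⟨Z, h, hZ, hh, rfl⟩, hmin⟩ := (wellFounded_lt (α := Submodule k V)).has_min
    {P | ∃ (Z : C) (h : B ⟶ Z), Indecomposable Z ∧ (¬ ∃ s, d ≫ s = g ≫ h) ∧ P = N h}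
    ⟨_, B, 𝟙 B, hB, by simpa using hg, rfl⟩
  have hind : ∀ (W : C) (w : Z ⟶ W), Indecomposable W → ¬ IsSplitMono w →
      ∃ s, d ≫ s = (g ≫ h) ≫ w := by
    intro W w hW hw
    by_contra hcon
    have hle : N (h ≫ w) ≤ N h := by
      intro φ hφ
      rw [hN] at hφ ⊢
      intro q
      obtain ⟨c, s, hcs⟩ := hφ q
      exact ⟨w ≫ c, s, by simpa using hcs⟩
    have hge : N h ≤ N (h ≫ w) := by
      by_contra hlt
      exact hmin _ ⟨W, h ≫ w, hW, by simpa using hcon, rfl⟩ (lt_of_le_not_ge hle hlt)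
    have hne : h ≠ 0 := by
      rintro rfl
      exact hh ⟨0, by simp⟩
    let q : S := ⟨Quotient.mk _ Z, Z, rfl, hZ, h, hne⟩
    obtain ⟨θ⟩ : IsIsomorphic (Quotient.out q.1) Z := Quotient.mk_out (s := isIsomorphicSetoid C) Z
    classical
    have hmem : (Pi.single q ((g ≫ h) ≫ θ.inv) : V) ∈ N h := by
      rw [hN]
      intro q'
      by_cases hq : q' = q
      · subst hq
        exact ⟨θ.inv, 0, by simp⟩
      · exact ⟨0, 0, by simp [Pi.single_eq_of_ne hq]⟩
    obtain ⟨c, s, hcs⟩ := (hN _ _).1 (hge hmem) q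
    rw [Pi.single_eq_same] at hcs
    have hcs' : (g ≫ h) ≫ (𝟙 Z - w ≫ c ≫ θ.hom) = d ≫ s ≫ θ.hom := by
      have := congrArg (· ≫ θ.hom) hcs
      simp only [Preadditive.add_comp, Category.assoc, Iso.inv_hom_id, Category.comp_id] at this
      simp only [Preadditive.comp_sub, Category.assoc, Category.comp_id]
      rw [← this]; abel
    have hi := (isIso_or_isIso_one_sub (hKS.isLocalRing_end hZ) (w ≫ c ≫ θ.hom)).resolve_left
      fun hi => hw ⟨⟨(c ≫ θ.hom) ≫ inv (w ≫ c ≫ θ.hom), by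
        rw [← Category.assoc]; exact IsIso.hom_inv_id _⟩⟩
    exact hh ⟨s ≫ θ.hom ≫ inv (𝟙 Z - w ≫ c ≫ θ.hom), by
      rw [← Category.assoc s, ← Category.assoc d, ← hcs', Category.assoc, IsIso.hom_inv_id,
        Category.comp_id]⟩
  refine ⟨Z, g ≫ h, hZ, hh, fun W w hw => ?_⟩
  obtain ⟨D⟩ := hKS.nonempty_localDecomposition W
  choose s hs using fun j => hind _ (w ≫ D.p j) (indecomposable_of_isLocalRing (D.isLocal j))
    fun hi => hw ⟨⟨D.p j ≫ retraction (w ≫ D.p j), by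
      rw [← Category.assoc]; exact IsSplitMono.id _⟩⟩
  refine ⟨∑ j, s j ≫ D.i j, ?_⟩
  rw [Preadditive.comp_sum]
  simp only [reassoc_of% hs]
  rw [← Preadditive.comp_sum, ← Preadditive.comp_sum, ← Preadditive.comp_sum, D.total,
    Category.comp_id, Category.assoc]

/-- If `d` is not a split epimorphism, the contravariant functor of morphisms to its target modulo
those factoring through `d` has a socle element on an indecomposable object. -/
theorem exists_socle_right (hfin : ∀ X Y : C, Module.Finite k (X ⟶ Y)) (hKS : IsKrullSchmidt C)
    (hloc : IsLocallyFinite C) {A M : C} (d : M ⟶ A) (hd : ¬ IsSplitEpi d) :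
    ∃ (Z : C) (g : Z ⟶ A), Indecomposable Z ∧ (¬ ∃ s, s ≫ d = g) ∧
      ∀ (W : C) (w : W ⟶ Z), ¬ IsSplitEpi w → ∃ s, s ≫ d = w ≫ g := by
  obtain ⟨B, g, hB, hg⟩ : ∃ (B : C) (g : B ⟶ A), Indecomposable B ∧ ¬ ∃ s, s ≫ d = g := by
    by_contra! hcon
    obtain ⟨D⟩ := hKS.nonempty_localDecomposition A
    choose s hs using fun j => hcon _ (D.i j) (indecomposable_of_isLocalRing (D.isLocal j))
    refine hd ⟨⟨∑ j, D.p j ≫ s j, ?_⟩⟩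
    rw [Preadditive.sum_comp, ← D.total]
    simp [hs]
  let S := {q : Quotient (isIsomorphicSetoid C) | ∃ Y : C, Quotient.mk _ Y = q ∧
    Indecomposable Y ∧ ∃ f : Y ⟶ B, f ≠ 0}
  have : Finite S := (hloc B hB).2.to_subtype
  let V := ∀ q : S, (Quotient.out q.1 ⟶ A)
  let N : ∀ {Z : C}, (Z ⟶ B) → Submodule k V := fun {Z} h =>
    Submodule.pi Set.univ (fun q =>
      LinearMap.range (Linear.rightComp k (Quotient.out q.1) (h ≫ g)) ⊔
        LinearMap.range (Linear.rightComp k (Quotient.out q.1) d))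
  have hN : ∀ {Z : C} (h : Z ⟶ B) (φ : V), φ ∈ N h ↔
      ∀ q, ∃ c s, c ≫ h ≫ g + s ≫ d = φ q := by
    intro Z h φ
    refine Submodule.mem_pi.trans ?_
    simp [Submodule.mem_sup]
  obtain ⟨_, ⟨Z, h, hZ, hh, rfl⟩, hmin⟩ := (wellFounded_lt (α := Submodule k V)).has_min
    {P | ∃ (Z : C) (h : Z ⟶ B), Indecomposable Z ∧ (¬ ∃ s, s ≫ d = h ≫ g) ∧ P = N h}
    ⟨_, B, 𝟙 B, hB, by simpa using hg, rfl⟩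
  have hind : ∀ (W : C) (w : W ⟶ Z), Indecomposable W → ¬ IsSplitEpi w →
      ∃ s, s ≫ d = w ≫ h ≫ g := by
    intro W w hW hw
    by_contra hcon
    have hle : N (w ≫ h) ≤ N h := by
      intro φ hφ
      rw [hN] at hφ ⊢
      intro q
      obtain ⟨c, s, hcs⟩ := hφ q
      exact ⟨c ≫ w, s, by simpa using hcs⟩
    have hge : N h ≤ N (w ≫ h) := by
      by_contra hlt
      exact hmin _ ⟨W, w ≫ h, hW, by simpa using hcon, rfl⟩ (lt_of_le_not_ge hle hlt)
    have hne : h ≠ 0 := by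
      rintro rfl
      exact hh ⟨0, by simp⟩
    let q : S := ⟨Quotient.mk _ Z, Z, rfl, hZ, h, hne⟩
    obtain ⟨θ⟩ : IsIsomorphic (Quotient.out q.1) Z := Quotient.mk_out (s := isIsomorphicSetoid C) Z
    classical
    have hmem : (Pi.single q (θ.hom ≫ h ≫ g) : V) ∈ N h := by
      rw [hN]
      intro q'
      by_cases hq : q' = q
      · subst hq
        exact ⟨θ.hom, 0, by simp⟩
      · exact ⟨0, 0, by simp [Pi.single_eq_of_ne hq]⟩
    obtain ⟨c, s, hcs⟩ := (hN _ _).1 (hge hmem) q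
    rw [Pi.single_eq_same] at hcs
    have hcs' : (𝟙 Z - (θ.inv ≫ c) ≫ w) ≫ h ≫ g = θ.inv ≫ s ≫ d := by
      have := congrArg (θ.inv ≫ ·) hcs
      simp only [Preadditive.comp_add, Category.assoc, Iso.inv_hom_id_assoc] at this
      simp only [Preadditive.sub_comp, Category.assoc, Category.id_comp]
      exact sub_eq_of_eq_add' this.symm
    have hi := (isIso_or_isIso_one_sub (hKS.isLocalRing_end hZ) ((θ.inv ≫ c) ≫ w)).resolve_left
      fun hi => hw ⟨⟨inv ((θ.inv ≫ c) ≫ w) ≫ θ.inv ≫ c, by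
        rw [Category.assoc]; exact IsIso.inv_hom_id _⟩⟩
    generalize 𝟙 Z - (θ.inv ≫ c) ≫ w = x at hcs' hi
    exact hh ⟨inv x ≫ θ.inv ≫ s, by
      rw [Category.assoc, Category.assoc, ← hcs', IsIso.inv_hom_id_assoc]⟩
  refine ⟨Z, h ≫ g, hZ, hh, fun W w hw => ?_⟩
  obtain ⟨D⟩ := hKS.nonempty_localDecomposition W
  choose s hs using fun j => hind _ (D.i j ≫ w) (indecomposable_of_isLocalRing (D.isLocal j))
    fun hi => hw ⟨⟨section_ (D.i j ≫ w) ≫ D.i j, by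
      rw [Category.assoc]; exact IsSplitEpi.id _⟩⟩
  refine ⟨∑ j, D.p j ≫ s j, ?_⟩
  rw [Preadditive.sum_comp]
  simp only [Category.assoc, hs]
  simp only [← Category.assoc]
  rw [← Preadditive.sum_comp, ← Preadditive.sum_comp, ← Preadditive.sum_comp, D.total,
    Category.id_comp]

end Socle

section AlmostSplit

variable {C : Type u} [Category.{v} C] [Preadditive C] [HasZeroObject C] [HasBinaryBiproducts C]
  {n : ℕ}

theorem NExactStructure.isRightAlmostSplit (E : NExactStructure C n) (hn : 1 ≤ n)
    {X : CochainComplex C ℕ} (hX : X ∈ E.adm) (hloc : IsLocalRing (End (X.X (n + 1))))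
    (hd : IsLeftAlmostSplit (X.d 0 1)) : IsRightAlmostSplit (X.d n (n + 1)) := by
  have hXe := E.isNExact X hX
  have hns : ¬ IsSplitEpi (X.d n (n + 1)) := fun h => hd.1 (hXe.isNKernel.isSplitMono h)
  refine ⟨hns, fun W h hh => ?_⟩
  obtain ⟨V, hV, φ, e, hφ, h0, _⟩ := E.exists_pullback hn hX h
  have hVe := E.isNExact V hV
  by_cases hsp : IsSplitMono (V.d 0 1)
  · obtain ⟨s, hs⟩ := hVe.isNCokernel.exists_last_factor φ (retraction (V.d 0 1) ≫ φ.f 0) (by simp)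
    exact ⟨e.inv ≫ s, by rw [Category.assoc, ← hs, hφ, Iso.inv_hom_id_assoc]⟩
  · obtain ⟨t, ht⟩ := hd.2 _ (inv (φ.f 0) ≫ V.d 0 1) fun hi => hsp ⟨⟨retraction
      (inv (φ.f 0) ≫ V.d 0 1) ≫ inv (φ.f 0), by
        have := IsSplitMono.id (inv (φ.f 0) ≫ V.d 0 1)
        rw [Category.assoc, IsIso.inv_comp_eq, Category.comp_id] at this
        rw [← Category.assoc, this, IsIso.hom_inv_id]⟩⟩
    obtain ⟨ψ, hψ, -⟩ := hXe.isNCokernel.exists_hom hXe.supported _ _ ht.symm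
    obtain ⟨s, hs⟩ := hXe.isNCokernel.exists_last_factor (𝟙 X - ψ ≫ φ) 0 (by simp [hψ])
    simp only [HomologicalComplex.sub_f_apply, HomologicalComplex.id_f,
      HomologicalComplex.comp_f, hφ] at hs
    have hi := (isIso_or_isIso_one_sub hloc (ψ.f (n + 1) ≫ e.hom ≫ h)).resolve_left fun hi =>
      hh ⟨⟨inv (ψ.f (n + 1) ≫ e.hom ≫ h) ≫ ψ.f (n + 1) ≫ e.hom, by simp⟩⟩
    rw [hs] at hi
    exact absurd ⟨⟨inv (s ≫ X.d n (n + 1)) ≫ s, by simp⟩⟩ hns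

theorem NExactStructure.isLeftAlmostSplit (E : NExactStructure C n) (hn : 1 ≤ n)
    {X : CochainComplex C ℕ} (hX : X ∈ E.adm) (hloc : IsLocalRing (End (X.X 0)))
    (hd : IsRightAlmostSplit (X.d n (n + 1))) : IsLeftAlmostSplit (X.d 0 1) := by
  have hXe := E.isNExact X hX
  have hns : ¬ IsSplitMono (X.d 0 1) := fun h => hd.1 (hXe.isNCokernel.isSplitEpi h)
  refine ⟨hns, fun W h hh => ?_⟩
  obtain ⟨V, hV, φ, e, hφ, h0, _⟩ := E.exists_pushout hn hX h
  have hVe := E.isNExact V hV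
  by_cases hsp : IsSplitEpi (V.d n (n + 1))
  · obtain ⟨s, hs⟩ := hVe.isNKernel.exists_first_factor φ (φ.f (n + 1) ≫ section_ (V.d n (n + 1)))
      (by simp)
    exact ⟨s ≫ e.inv, by rw [← Category.assoc, ← hs, hφ, Category.assoc, e.hom_inv_id,
      Category.comp_id]⟩
  · obtain ⟨t, ht⟩ := hd.2 _ (V.d n (n + 1) ≫ inv (φ.f (n + 1))) fun hi => hsp ⟨⟨inv (φ.f (n + 1)) ≫
      section_ (V.d n (n + 1) ≫ inv (φ.f (n + 1))), by
        have := IsSplitEpi.id (V.d n (n + 1) ≫ inv (φ.f (n + 1)))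
        rw [← Category.assoc, IsIso.comp_inv_eq, Category.id_comp] at this
        rw [Category.assoc, this, IsIso.inv_hom_id]⟩⟩
    obtain ⟨ψ, -, hψ⟩ := hXe.isNKernel.exists_hom hXe.supported _ _ ht
    obtain ⟨s, hs⟩ := hXe.isNKernel.exists_first_factor (𝟙 X - φ ≫ ψ) 0 (by simp [hψ])
    simp only [HomologicalComplex.sub_f_apply, HomologicalComplex.id_f,
      HomologicalComplex.comp_f, hφ] at hs
    have hi := (isIso_or_isIso_one_sub hloc ((h ≫ e.hom) ≫ ψ.f 0)).resolve_left fun hi =>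
      hh ⟨⟨(e.hom ≫ ψ.f 0) ≫ inv ((h ≫ e.hom) ≫ ψ.f 0), by
        rw [← Category.assoc, ← Category.assoc, IsIso.hom_inv_id]⟩⟩
    rw [hs] at hi
    exact absurd ⟨⟨s ≫ inv (X.d 0 1 ≫ s), by rw [← Category.assoc, IsIso.hom_inv_id]⟩⟩ hns

end AlmostSplit

section Retract

variable {C : Type u} [Category.{v} C] [Preadditive C] {n : ℕ} {X Z : CochainComplex C ℕ}

theorem IsNExact.of_retract (hX : IsNExact n X) (ι : Z ⟶ X) (p : X ⟶ Z) (h : ι ≫ p = 𝟙 Z) :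
    IsNExact n Z := by
  have hj : ∀ j, ι.f j ≫ p.f j = 𝟙 (Z.X j) := fun j => by
    rw [← HomologicalComplex.comp_f, h, HomologicalComplex.id_f]
  refine ⟨fun i hi => ?_, ⟨fun W a ha => ?_, fun i hi W a ha => ?_⟩,
    ⟨fun W a ha => ?_, fun i hi W a ha => ?_⟩⟩
  · rw [IsZero.iff_id_eq_zero, ← hj, (hX.supported i hi).eq_of_tgt (ι.f i) 0, zero_comp]
  · have := hX.isNKernel.eq_zero W (a ≫ ι.f 0) (by
      rw [Category.assoc, ι.comm, reassoc_of% ha, zero_comp])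
    rw [← Category.comp_id a, ← hj, reassoc_of% this, zero_comp]
  · obtain ⟨b, hb⟩ := hX.isNKernel.exact i hi W (a ≫ ι.f (i + 1)) (by
      rw [Category.assoc, ι.comm, reassoc_of% ha, zero_comp])
    exact ⟨b ≫ p.f i, by rw [Category.assoc, p.comm, reassoc_of% hb, hj, Category.comp_id]⟩
  · have := hX.isNCokernel.eq_zero W (p.f (n + 1) ≫ a) (by
      rw [← p.comm_assoc, ha, comp_zero])
    rw [← Category.id_comp a, ← hj, Category.assoc, this, comp_zero]
  · obtain ⟨b, hb⟩ := hX.isNCokernel.exact i hi W (p.f (i + 1) ≫ a) (by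
      rw [← p.comm_assoc, ha, comp_zero])
    exact ⟨ι.f (i + 2) ≫ b, by rw [← ι.comm_assoc, hb, ← Category.assoc, hj, Category.id_comp]⟩

/-- An endomorphism of complexes that splits in each degree splits. -/
theorem exists_retract_of_split (e : X ⟶ X)
    (h : ∀ j, ∃ (T : C) (a : T ⟶ X.X j) (b : X.X j ⟶ T), a ≫ b = 𝟙 T ∧ b ≫ a = e.f j) :
    ∃ (Z : CochainComplex C ℕ) (ι : Z ⟶ X) (p : X ⟶ Z), ι ≫ p = 𝟙 Z ∧ p ≫ ι = e := by
  choose T a b hab hba using h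
  have hea : ∀ j, a j ≫ e.f j = a j := fun j => by rw [← hba, reassoc_of% (hab j)]
  have heb : ∀ j, e.f j ≫ b j = b j := fun j => by
    rw [← hba, Category.assoc, hab, Category.comp_id]
  let Z : CochainComplex C ℕ :=
    { X := T
      d := fun i j => a i ≫ X.d i j ≫ b j
      shape := fun i j hij => by simp [X.shape i j hij]
      d_comp_d' := fun i j l _ _ => by
        have : a i ≫ X.d i j ≫ (b j ≫ a j) ≫ X.d j l ≫ b l = 0 := by
          rw [hba, ← e.comm_assoc]; simp
        simpa using this }
  refine ⟨Z, { f := a, comm' := fun i j _ => ?_ }, { f := b, comm' := fun i j _ => ?_ }, ?_, ?_⟩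
  · change a i ≫ X.d i j = (a i ≫ X.d i j ≫ b j) ≫ a j
    rw [Category.assoc, Category.assoc, hba, ← e.comm, reassoc_of% (hea i)]
  · change b i ≫ a i ≫ X.d i j ≫ b j = X.d i j ≫ b j
    rw [← Category.assoc, hba, e.comm_assoc, heb]
  · ext j; exact hab j
  · ext j; exact hba j

/-- A contractible summand in degrees `i` and `i + 1` can be split off a complex if the differential
between these degrees is not in the radical. -/
theorem exists_retract_of_not_inRad [HasZeroObject C] [HasBinaryBiproducts C]
    (hKS : IsKrullSchmidt C) (X : CochainComplex C ℕ) {i : ℕ} (hi : 1 ≤ i)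
    (h : ¬ InRad (X.d i (i + 1))) :
    ∃ (Z : CochainComplex C ℕ) (ι : Z ⟶ X) (p : X ⟶ Z), ι ≫ p = 𝟙 Z ∧
      (∀ j, j ≠ i → j ≠ i + 1 → p.f j ≫ ι.f j = 𝟙 (X.X j)) ∧ p.f i ≫ ι.f i ≠ 𝟙 (X.X i) := by
  obtain ⟨F, s, r, hF, hsr⟩ := hKS.exists_of_not_inRad h
  obtain ⟨m, rfl⟩ : ∃ m, i = m + 1 := ⟨i - 1, by omega⟩
  replace hsr : s ≫ X.d (m + 1) (m + 2) ≫ r = 𝟙 F := hsr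
  let u : ∀ j, X.X (j + 1) ⟶ X.X j := Function.update (fun _ => 0) (m + 1) (r ≫ s)
  have hu : u (m + 1) = r ≫ s := Function.update_self ..
  have hu' : ∀ j, j ≠ m + 1 → u j = 0 := fun j hj => Function.update_of_ne hj ..
  let N : ∀ j, X.X j ⟶ X.X j := fun j => match j with
    | 0 => X.d 0 1 ≫ u 0
    | j + 1 => X.d (j + 1) (j + 2) ≫ u (j + 1) + u j ≫ X.d j (j + 1)
  have hN₀ : N 0 = X.d 0 1 ≫ u 0 := rfl
  have hN₁ : ∀ j, N (j + 1) = X.d (j + 1) (j + 2) ≫ u (j + 1) + u j ≫ X.d j (j + 1) :=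
    fun _ => rfl
  let e : X ⟶ X :=
    { f := fun j => 𝟙 _ - N j
      comm' := by
        rintro i j (rfl : i + 1 = j)
        cases i with
        | zero => rw [hN₀, hN₁]; simp
        | succ i => rw [hN₁, hN₁]; simp }
  have he : ∀ j, e.f j = 𝟙 _ - N j := fun _ => rfl
  have he₁ : e.f (m + 1) = 𝟙 _ - (X.d (m + 1) (m + 2) ≫ r) ≫ s := by
    rw [he, hN₁, hu, hu' m (by omega)]; simp
  have he₂ : e.f (m + 2) = 𝟙 _ - r ≫ s ≫ X.d (m + 1) (m + 2) := by
    rw [he, hN₁, hu, hu' (m + 2) (by omega)]; simp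
  have he₃ : ∀ j, j ≠ m + 1 → j ≠ m + 2 → e.f j = 𝟙 _ := by
    intro j h1 h2
    rw [he]
    cases j with
    | zero => rw [hN₀, hu' 0 h1]; simp
    | succ j => rw [hN₁, hu' _ h1, hu' j (by omega)]; simp
  obtain ⟨Z, ι, p, h1, h2⟩ := exists_retract_of_split e (fun j => by
    by_cases hj : j = m + 1
    · subst hj
      rw [he₁]
      exact hKS.exists_complement hF s (X.d (m + 1) (m + 2) ≫ r) hsr
    · by_cases hj' : j = m + 2
      · subst hj'
        rw [he₂]
        exact hKS.exists_complement hF (s ≫ X.d (m + 1) (m + 2)) r (by simpa using hsr)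
      · exact ⟨X.X j, 𝟙 _, 𝟙 _, by simp, by rw [he₃ j hj hj']; simp⟩)
  have h3 : ∀ j, p.f j ≫ ι.f j = e.f j := fun j => by rw [← HomologicalComplex.comp_f, h2]
  refine ⟨Z, ι, p, h1, fun j hj hj' => by rw [h3, he₃ j hj hj'], fun hcon => ?_⟩
  rw [h3, he₁, sub_eq_self] at hcon
  refine id_ne_zero_of_isLocalRing hF ?_
  calc 𝟙 F = s ≫ ((X.d (m + 1) (m + 2) ≫ r) ≫ s) ≫ X.d (m + 1) (m + 2) ≫ r := by
        simp [hsr]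
    _ = 0 := by rw [hcon]; simp

end Retract

section Minimal

variable {k : Type w} [Field k] {C : Type u} [Category.{v} C] [Preadditive C] [Linear k C]

theorem finrank_end_le_of_retract (hfin : ∀ X Y : C, Module.Finite k (X ⟶ Y)) {T X : C}
    {a : T ⟶ X} {b : X ⟶ T} (h : a ≫ b = 𝟙 T) :
    Module.finrank k (T ⟶ T) ≤ Module.finrank k (X ⟶ X) ∧
      (b ≫ a ≠ 𝟙 X → Module.finrank k (T ⟶ T) < Module.finrank k (X ⟶ X)) := by
  have := hfin T T
  have := hfin X X
  let φ : (T ⟶ T) →ₗ[k] (X ⟶ X) := Linear.leftComp k X b ∘ₗ Linear.rightComp k T a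
  have hφ : ∀ x, φ x = b ≫ x ≫ a := fun _ => rfl
  have hinj : Function.Injective φ := fun x y hxy => by
    have := congrArg (fun t => a ≫ t ≫ b) hxy
    simpa [hφ, h, reassoc_of% h] using this
  have hle := LinearMap.finrank_le_finrank_of_injective hinj
  refine ⟨hle, fun hne => lt_of_le_of_ne hle fun heq => hne ?_⟩
  obtain ⟨x, hx⟩ := (LinearMap.injective_iff_surjective_of_finrank_eq_finrank heq).1 hinj (𝟙 X)
  rw [hφ] at hx
  calc b ≫ a = (b ≫ a) ≫ b ≫ x ≫ a := by rw [hx, Category.comp_id]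
    _ = 𝟙 X := by rw [Category.assoc, reassoc_of% h, hx]

variable [HasZeroObject C] [HasBinaryBiproducts C] {n : ℕ}

/-- Each admissible sequence has a retract with the same end terms which is admissible and whose
inner differentials are in the radical. -/
theorem NExactStructure.exists_minimal (hfin : ∀ X Y : C, Module.Finite k (X ⟶ Y))
    (hKS : IsKrullSchmidt C) (E : NExactStructure C n) (X : CochainComplex C ℕ) (hX : X ∈ E.adm) :
    ∃ Z ∈ E.adm, ∃ (ι : Z ⟶ X) (p : X ⟶ Z), ι ≫ p = 𝟙 Z ∧ p.f 0 ≫ ι.f 0 = 𝟙 (X.X 0) ∧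
      p.f (n + 1) ≫ ι.f (n + 1) = 𝟙 (X.X (n + 1)) ∧
      ∀ i, 1 ≤ i → i < n → InRad (Z.d i (i + 1)) := by
  induction hN : ∑ j ∈ Finset.range (n + 2), Module.finrank k (X.X j ⟶ X.X j) using
    Nat.strong_induction_on generalizing X with
  | _ N ih =>
    by_cases hrad : ∀ i, 1 ≤ i → i < n → InRad (X.d i (i + 1))
    · exact ⟨X, hX, 𝟙 X, 𝟙 X, by simp, by simp, by simp, hrad⟩
    push Not at hrad
    obtain ⟨i, hi, hin, hr⟩ := hrad
    obtain ⟨Z, ι, p, h1, h2, h3⟩ := exists_retract_of_not_inRad hKS X hi hr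
    have hj : ∀ j, ι.f j ≫ p.f j = 𝟙 (Z.X j) := fun j => by
      rw [← HomologicalComplex.comp_f, h1, HomologicalComplex.id_f]
    have h4 := h2 0 (by omega) (by omega)
    have h5 := h2 (n + 1) (by omega) (by omega)
    have hZ : Z ∈ E.adm := (E.weakIso_closed Z X ι ((E.isNExact X hX).of_retract ι p h1)
      (E.isNExact X hX) (Or.inr ⟨⟨p.f _, hj _, h5⟩, ⟨p.f _, hj _, h4⟩⟩)).2 hX
    obtain ⟨Z', hZ', ι', p', g1, g2, g3, g4⟩ := ih _ (by
      rw [← hN]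
      exact Finset.sum_lt_sum (fun j _ => (finrank_end_le_of_retract hfin (hj j)).1)
        ⟨i, by simp; omega, (finrank_end_le_of_retract hfin (hj i)).2 h3⟩) Z hZ rfl
    refine ⟨Z', hZ', ι' ≫ ι, p ≫ p', ?_, ?_, ?_, g4⟩
    · rw [Category.assoc, reassoc_of% h1, g1]
    · simp [reassoc_of% g2, h4]
    · simp [reassoc_of% g3, h5]

theorem NExactStructure.exists_isAuslanderReitenSequence
    (hfin : ∀ X Y : C, Module.Finite k (X ⟶ Y)) (hKS : IsKrullSchmidt C) (hn : 1 ≤ n)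
    (E : NExactStructure C n) {X : CochainComplex C ℕ} (hX : X ∈ E.adm)
    (hd : IsLeftAlmostSplit (X.d 0 1)) (hA : Indecomposable (X.X (n + 1))) :
    ∃ Z, E.IsAuslanderReitenSequence Z ∧ Nonempty (Z.X 0 ≅ X.X 0) ∧
      Nonempty (Z.X (n + 1) ≅ X.X (n + 1)) := by
  obtain ⟨Z, hZ, ι, p, h1, h2, h3, h4⟩ := E.exists_minimal hfin hKS X hX
  have hj : ∀ j, ι.f j ≫ p.f j = 𝟙 (Z.X j) := fun j => by
    rw [← HomologicalComplex.comp_f, h1, HomologicalComplex.id_f]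
  let e₀ : Z.X 0 ≅ X.X 0 := ⟨ι.f 0, p.f 0, hj 0, h2⟩
  let e₁ : Z.X (n + 1) ≅ X.X (n + 1) := ⟨ι.f _, p.f _, hj _, h3⟩
  have hdZ : IsLeftAlmostSplit (Z.d 0 1) := by
    refine ⟨fun hs => hd.1 ⟨⟨p.f 1 ≫ retraction (Z.d 0 1) ≫ ι.f 0, ?_⟩⟩, fun W h hh => ?_⟩
    · rw [← p.comm_assoc, IsSplitMono.id_assoc, h2]
    · obtain ⟨s, hs⟩ := hd.2 W (p.f 0 ≫ h) fun hi => hh ⟨⟨retraction (p.f 0 ≫ h) ≫ p.f 0, by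
        have := congrArg (fun t => ι.f 0 ≫ t ≫ p.f 0) (IsSplitMono.id (p.f 0 ≫ h))
        simpa only [Category.assoc, reassoc_of% (hj 0), Category.id_comp, hj] using this⟩⟩
      exact ⟨ι.f 1 ≫ s, by rw [← ι.comm_assoc, hs, reassoc_of% (hj 0)]⟩
  have hA' : Indecomposable (Z.X (n + 1)) :=
    ⟨fun h => hA.1 (h.of_iso e₁.symm), fun Y Y' i => hA.2 Y Y' (e₁.symm ≪≫ i)⟩
  exact ⟨Z, ⟨hZ, hdZ, E.isRightAlmostSplit hn hZ (hKS.isLocalRing_end hA') hdZ, h4⟩,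
    ⟨e₀⟩, ⟨e₁⟩⟩

theorem NExactStructure.exists_isLeftAlmostSplit (hfin : ∀ X Y : C, Module.Finite k (X ⟶ Y))
    (hKS : IsKrullSchmidt C) (hloc : IsLocallyFinite C) (hn : 1 ≤ n) (E : NExactStructure C n)
    {A : C} (hA : ¬ E.IsProjective A) :
    ∃ X ∈ E.adm, IsLeftAlmostSplit (X.d 0 1) ∧ Nonempty (X.X (n + 1) ≅ A) := by
  simp only [NExactStructure.IsProjective, not_forall] at hA
  obtain ⟨X, hX, c, hc⟩ := hA
  obtain ⟨V, hV, φ, e, hφ, -, -⟩ := E.exists_pullback hn hX c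
  have hns : ¬ IsSplitMono (V.d 0 1) := fun h => by
    have := (E.isNExact V hV).isNCokernel.isSplitEpi h
    exact hc ⟨e.inv ≫ section_ (V.d n (n + 1)) ≫ φ.f n, by simp [hφ]⟩
  obtain ⟨Z, g, hZ, hg, hgw⟩ := exists_socle_left hfin hKS hloc _ hns
  obtain ⟨Y, hY, ψ, i, hψ, hiso, hdesc⟩ := E.exists_pushout hn hV g
  refine ⟨Y, hY, ⟨fun hs => hg ⟨ψ.f 1 ≫ retraction (Y.d 0 1) ≫ i.inv, ?_⟩, fun W h hh => ?_⟩,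
    ⟨(asIso (ψ.f (n + 1))).symm ≪≫ e⟩⟩
  · rw [← ψ.comm_assoc, IsSplitMono.id_assoc, hψ]; simp
  · obtain ⟨r, hr⟩ := hdesc W (i.hom ≫ h) (hgw W _ fun hi => hh
      ⟨⟨retraction (i.hom ≫ h) ≫ i.hom, by
        have := congrArg (fun t => i.inv ≫ t ≫ i.hom) (IsSplitMono.id (i.hom ≫ h))
        simpa only [Category.assoc, Iso.inv_hom_id_assoc, Category.id_comp,
          Iso.inv_hom_id] using this⟩⟩)
    exact ⟨r, by simpa using hr⟩

theorem NExactStructure.exists_isRightAlmostSplit (hfin : ∀ X Y : C, Module.Finite k (X ⟶ Y))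
    (hKS : IsKrullSchmidt C) (hloc : IsLocallyFinite C) (hn : 1 ≤ n) (E : NExactStructure C n)
    {B : C} (hB : ¬ E.IsInjective B) :
    ∃ X ∈ E.adm, IsRightAlmostSplit (X.d n (n + 1)) ∧ Indecomposable (X.X (n + 1)) ∧
      Nonempty (X.X 0 ≅ B) := by
  simp only [NExactStructure.IsInjective, not_forall] at hB
  obtain ⟨X, hX, c, hc⟩ := hB
  obtain ⟨V, hV, φ, e, hφ, -, -⟩ := E.exists_pushout hn hX c
  have hns : ¬ IsSplitEpi (V.d n (n + 1)) := fun h => by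
    have := (E.isNExact V hV).isNKernel.isSplitMono h
    exact hc ⟨φ.f 1 ≫ retraction (V.d 0 1) ≫ e.inv, by
      rw [← φ.comm_assoc, IsSplitMono.id_assoc, hφ]; simp⟩
  obtain ⟨Z, g, hZ, hg, hgw⟩ := exists_socle_right hfin hKS hloc _ hns
  obtain ⟨Y, hY, ψ, i, hψ, hiso, hlift⟩ := E.exists_pullback hn hV g
  refine ⟨Y, hY, ⟨fun hs => hg ⟨i.inv ≫ section_ (Y.d n (n + 1)) ≫ ψ.f n, ?_⟩, fun W h hh => ?_⟩,
    ⟨fun h => hZ.1 (h.of_iso i.symm), fun U U' j => hZ.2 U U' (i.symm ≪≫ j)⟩,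
    ⟨asIso (ψ.f 0) ≪≫ e.symm⟩⟩
  · simp [hψ]
  · obtain ⟨r, hr⟩ := hlift W (h ≫ i.hom) (hgw W _ fun hi => hh
      ⟨⟨i.hom ≫ section_ (h ≫ i.hom), by
        have := congrArg (fun t => i.hom ≫ t ≫ i.inv) (IsSplitEpi.id (h ≫ i.hom))
        simpa only [Category.assoc, Iso.hom_inv_id, Category.id_comp,
          Category.comp_id] using this⟩⟩)
    exact ⟨r, by simpa using hr⟩

end Minimal

end HigherExact

theorem corollary3p13 {k : Type w} [Field k] {C : Type u} [Category.{v} C] [Preadditive C]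
    [HasZeroObject C] [HasBinaryBiproducts C] [Linear k C]
    (hfin : ∀ X Y : C, Module.Finite k (X ⟶ Y)) (hKS : HigherExact.IsKrullSchmidt C)
    (n : ℕ) (hn : 1 ≤ n) (E : HigherExact.NExactStructure C n)
    (hloc : HigherExact.IsLocallyFinite C) :
    E.HasAuslanderReitenSequences := by
  refine ⟨fun A hA hAp => ?_, fun B hB hBi => ?_⟩
  · obtain ⟨X, hX, hd, ⟨e⟩⟩ := E.exists_isLeftAlmostSplit hfin hKS hloc hn hAp
    obtain ⟨Z, hZ, -, ⟨e'⟩⟩ := E.exists_isAuslanderReitenSequence hfin hKS hn hX hd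
      ⟨fun h => hA.1 (h.of_iso e.symm), fun Y Y' i => hA.2 Y Y' (e.symm ≪≫ i)⟩
    exact ⟨Z, hZ, ⟨e' ≪≫ e⟩⟩
  · obtain ⟨X, hX, hd, hA, ⟨e⟩⟩ := E.exists_isRightAlmostSplit hfin hKS hloc hn hBi
    have hB' : Indecomposable (X.X 0) :=
      ⟨fun h => hB.1 (h.of_iso e.symm), fun Y Y' i => hB.2 Y Y' (e.symm ≪≫ i)⟩
    obtain ⟨Z, hZ, ⟨e'⟩, -⟩ := E.exists_isAuslanderReitenSequence hfin hKS hn hX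
      (E.isLeftAlmostSplit hn hX (hKS.isLocalRing_end hB') hd) hA
    exact ⟨Z, hZ, ⟨e' ≪≫ e⟩⟩
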